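/- **Definitions.** Let $F$ be a field. A pair $(g,h)$ of polynomials in $F[x]$, both of degree at least two, with $f=g\circ h$ is a *decomposition* of $f$; a polynomial without a decomposition is *indecomposable*. A polynomial is *normal* if it is monic and vanishes at $0$. A decomposition $(g,h)$ is *minimal* if $h$ is normal and indecomposable. For a permutation group $G$ on a finite set $Z$, a *block* is a set $B\subseteq Z$ such that for every $\sigma\in G$ the set $\sigma(B)\cap B$ is empty or equal to $B$; the blocks $\emptyset$, $Z$ and $\{\gamma\}$ are *trivial*; $G$ is *primitive* if all its blocks are trivial; a nontrivial block is *minimal* if every block contained in it is trivial or equal to it. $\mathrm{Atkinson}(G,Z,\alpha)$ denotes a subroutine that returns a list of all minimal blocks of $G$ containing $\alpha$, and the list consisting of $Z$ only if $G$ is primitive. **Algorithm minDec.** Input: a monic $f\in F[x]$ of degree $n$ with $f'\neq 0$. Output: a list of pairs $(g,h)$, initially empty. Let $F(\alpha)$ be the rational function field in $\alpha$. 1. Factor $f(x)-f(\alpha)=\prod_{i=1}^{r}\psi_i$ into monic irreducible polynomials in $F(\alpha)[x]$, where $\psi_i=x-\alpha_i$ with $\alpha_i\in F(\alpha)$ for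 $1\le i\le s$, $\alpha_1=\alpha$, and $\deg\psi_i\ge 2$ for $s<i\le r$. 2. If $s>1$: put $B_\alpha=\{\alpha_1,\dots,\alpha_s\}$ and $H=\{\ell_1,\dots,\ell_s\}$, where $\ell_i\in F[x]$ is the linear polynomial with $\alpha_i=\ell_i(\alpha)$, regarded as a permutation group on $B_\alpha$ (with $\ell\in H$ acting by $\gamma\mapsto\ell(\gamma)$). For each $\Lambda$ in $\mathrm{Atkinson}(H,B_\alpha,\alpha)$ with $|\Lambda|<n$, compute $h=\prod_{\gamma\in\Lambda}(x-\gamma)-\prod_{\gamma\in\Lambda}(-\gamma)\in F[x]$, compute $g\in F[x]$ with $f=g\circ h$, and append $(g,h)$ to the list. 3. For each $\nu$ with $s<\nu\le r$: let $\beta$ be a root of $\psi_\nu$ in an algebraic closure of $F(\alpha)$, and let $\psi_i^*$ be $\psi_i$ with $\beta$ substituted for $\alpha$. Let $\Gamma_\beta$ be the bipartite graph with vertices $\psi_1,\dots,\psi_r$ and $\psi_1^*,\dots,\psi_r^*$ and an edge between $\psi_i$ and $\psi_j^*$ whenever $\gcd(\psi_i,\psi_j^*)\neq 1$. Let $I_\nu=\{i:\psi_i\text{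 is connected to }\psi_1\text{ in }\Gamma_\beta\}$. If $I_\nu\ne\{1,\dots,r\}$, compute the normal $h\in F[x]$ with $h(x)-h(\alpha)=\prod_{i\in I_\nu}\psi_i$, compute $g\in F[x]$ with $f=g\circ h$, and append $(g,h)$ to the list. 4. Return the list. **Theorem.** Let $f\in F[x]$ be monic with $f'\ne 0$. Then minDec correctly computes all minimal decompositions of $f$. That is, a factorization as in step 1 and roots as in step 3 exist, and for every choice of the order of the factors and of the roots $\beta$: no step fails (all the objects to be computed exist, and $H$ is a permutation group on $B_\alpha$); every pair in the returned list is a decomposition of $f$; every minimal decomposition of $f$ is in the list; and the list is empty if $f$ is indecomposable. -/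

import Mathlib

open Polynomial

namespace MinDec

universe u

/-! ## Decompositions of polynomials -/

section Decompositions

variable {F : Type u} [Field F]

/-- `(g, h)` is a decomposition of `f`: both components have degree at least two and
`f = g ∘ h`. -/
def IsDecomposition (f g h : F[X]) : Prop :=
  2 ≤ g.natDegree ∧ 2 ≤ h.natDegree ∧ f = g.comp h

/-- A polynomial is indecomposable if it has no decomposition over `F`. -/
def IsIndecomposable (f : F[X]) : Prop :=
  ¬ ∃ g h : F[X], IsDecomposition f g h

/-- A polynomial is normal if it is monic and has a root at zero. -/
def IsNormal (f : F[X]) : Prop :=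
  f.Monic ∧ f.eval 0 = 0

/-- A decomposition `(g, h)` is minimal if `h` is normal and indecomposable. -/
def IsMinimalDecomposition (f g h : F[X]) : Prop :=
  IsDecomposition f g h ∧ IsNormal h ∧ IsIndecomposable h

end Decompositions

/-! ## Minimal blocks of a permutation group -/

section Blocks

variable {Z : Type u}

/-- A permutation group on `Z` is primitive if all of its blocks are trivial
(empty, a single point, or `Z`). -/
def IsPrimitive (G : Subgroup (Equiv.Perm Z)) : Prop :=
  ∀ B : Set Z, MulAction.IsBlock G B → MulAction.IsTrivialBlock B

/-- A nontrivial block is minimal if each block contained in it is trivial or equal to it. -/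
def IsMinimalBlock (G : Subgroup (Equiv.Perm Z)) (B : Set Z) : Prop :=
  MulAction.IsBlock G B ∧ ¬ MulAction.IsTrivialBlock B ∧
    ∀ B' : Set Z, B' ⊆ B → MulAction.IsBlock G B' → MulAction.IsTrivialBlock B' ∨ B' = B

open Classical in
/-- The subroutine `Atkinson(G, Z, a)`: a list of all minimal blocks of `G` that contain `a`;
if `G` is primitive, the list consists of `Z` only. -/
noncomputable def atkinson [Fintype Z] (G : Subgroup (Equiv.Perm Z)) (a : Z) :
    List (Finset Z) :=
  if IsPrimitive G then [Finset.univ]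
  else (Finset.univ.filter fun B : Finset Z => IsMinimalBlock G (B : Set Z) ∧ a ∈ B).toList

end Blocks

/-! ## The algorithm -/

open Classical in
/-- An elementary step "compute an object with the property `P`".  The step fails (`none`) if no
such object exists. -/
noncomputable def compute {A : Type u} (P : A → Prop) : Option A :=
  if h : ∃ a, P a then some h.choose else none

section Algorithm

variable {F : Type u} [Field F]

/-- `p(α)` in the rational function field `F(α)`, where `α = RatFunc.X`. -/
noncomputable def atAlpha (p : F[X]) : RatFunc F :=
  p.eval₂ RatFunc.C RatFunc.X

/-- `p(x) - p(α)` in `F(α)[x]`. -/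
noncomputable def subAlpha (p : F[X]) : (RatFunc F)[X] :=
  p.map RatFunc.C - C (atAlpha p)

/-- A possible result of factoring `f(x) - f(α)` in `F(α)[x]` into monic irreducible factors:
`∏_{i < s} (x - α_i) · ψ_s ⋯ ψ_{r-1}` with `α_0 = α` and `deg ψ_i ≥ 2` for `s ≤ i < r`
(the indices start at `0`). -/
structure Factorization (f : F[X]) where
  /-- the number of factors -/
  r : ℕ
  /-- the number of linear factors -/
  s : ℕ
  s_pos : 0 < s
  s_le_r : s ≤ r
  /-- the roots of the linear factors -/
  root : Fin s → RatFunc F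
  /-- the irreducible factors -/
  ψ : Fin r → (RatFunc F)[X]
  root_zero : root ⟨0, s_pos⟩ = RatFunc.X
  ψ_linear : ∀ i : Fin s, ψ (Fin.castLE s_le_r i) = X - C (root i)
  two_le_natDegree : ∀ i : Fin r, s ≤ (i : ℕ) → 2 ≤ (ψ i).natDegree
  monic : ∀ i, (ψ i).Monic
  irreducible : ∀ i, Irreducible (ψ i)
  prod_eq : ∏ i, ψ i = subAlpha f

/-- The arbitrary choices in a run of the algorithm: an order of the irreducible factors, and
for each `ν` with `s ≤ ν < r` a root `β_ν` of `ψ_ν` in an algebraic closure of `F(α)`. -/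
structure Choices (f : F[X]) extends Factorization f where
  β : ∀ ν : Fin r, s ≤ (ν : ℕ) → AlgebraicClosure (RatFunc F)
  β_root : ∀ (ν : Fin r) (hν : s ≤ (ν : ℕ)), aeval (β ν hν) (ψ ν) = 0

/-- `p^*`: the polynomial `p ∈ F(α)[x]` with `b` substituted for `α` in each coefficient. -/
noncomputable def substAlpha (b : AlgebraicClosure (RatFunc F)) (p : (RatFunc F)[X]) :
    (AlgebraicClosure (RatFunc F))[X] :=
  p.sum fun k c =>
    monomial k (c.eval ((algebraMap (RatFunc F) (AlgebraicClosure (RatFunc F))).comp RatFunc.C) b)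

/-- The bipartite graph `Γ_b`.  Its vertices are the `ψ_i` (as `Sum.inl i`) and the `ψ_j^*`
(as `Sum.inr j`), with an edge between `ψ_i` and `ψ_j^*` if `gcd(ψ_i, ψ_j^*) ≠ 1`. -/
noncomputable def gcdGraph {r : ℕ} (ψ : Fin r → (RatFunc F)[X])
    (b : AlgebraicClosure (RatFunc F)) : SimpleGraph (Fin r ⊕ Fin r) :=
  SimpleGraph.fromRel fun v w => ∃ i j, v = Sum.inl i ∧ w = Sum.inr j ∧
    ¬ IsCoprime ((ψ i).map (algebraMap (RatFunc F) (AlgebraicClosure (RatFunc F))))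
        (substAlpha b (ψ j))

namespace Factorization

variable {f : F[X]} (D : Factorization f)

open Classical in
/-- `B_α = {α_i}`. -/
noncomputable def Bα : Finset (RatFunc F) :=
  Finset.univ.image D.root

open Classical in
/-- The element `α` of `B_α`. -/
noncomputable def α : D.Bα :=
  ⟨RatFunc.X, Finset.mem_image.mpr ⟨⟨0, D.s_pos⟩, Finset.mem_univ _, D.root_zero⟩⟩

/-- The index of the factor `x - α`. -/
def zeroIdx : Fin D.r :=
  ⟨0, lt_of_lt_of_le D.s_pos D.s_le_r⟩

/-- The linear polynomials `ℓ_i ∈ F[x]` with `α_i = ℓ_i(α)`. -/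
noncomputable def linearMaps : Option (List F[X]) :=
  (List.finRange D.s).mapM fun i => compute fun l : F[X] =>
    l.natDegree = 1 ∧ atAlpha l = D.root i

/-- The list `H` of linear polynomials as a permutation group on `B_α`, each `ℓ ∈ H` acting as
`γ ↦ ℓ(γ)`.  This fails if these maps are not the elements of a permutation group on `B_α`. -/
noncomputable def permGroup (H : List F[X]) : Option (Subgroup (Equiv.Perm D.Bα)) :=
  compute fun G : Subgroup (Equiv.Perm D.Bα) =>
    (∀ l ∈ H, ∃ σ ∈ G, ∀ γ : D.Bα, ((σ γ : D.Bα) : RatFunc F) = l.eval₂ RatFunc.C (γ : RatFunc F)) ∧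
    (∀ σ ∈ G, ∃ l ∈ H, ∀ γ : D.Bα, ((σ γ : D.Bα) : RatFunc F) = l.eval₂ RatFunc.C (γ : RatFunc F))

/-- The decomposition computed from a block `Λ ⊆ B_α`:
`h = ∏_{γ ∈ Λ} (x - γ) - ∏_{γ ∈ Λ} (-γ)`, and `g` with `f = g ∘ h`. -/
noncomputable def fromBlock (Λ : Finset D.Bα) : Option (F[X] × F[X]) := do
  let h ← compute fun h : F[X] => h.map RatFunc.C =
    (∏ γ ∈ Λ, (X - C (γ : RatFunc F))) - C (∏ γ ∈ Λ, (-(γ : RatFunc F)))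
  let g ← compute fun g : F[X] => f = g.comp h
  return (g, h)

/-- The part of the algorithm for `s > 1`: the decompositions obtained from the blocks `Λ` with
`|Λ| < n = deg f` in the list `Atkinson(H, B_α, α)`. -/
noncomputable def linearPart : Option (List (F[X] × F[X])) :=
  if 1 < D.s then do
    let H ← D.linearMaps
    let G ← D.permGroup H
    ((atkinson G D.α).filter fun Λ => decide (Λ.card < f.natDegree)).mapM D.fromBlock
  else
    return []

open Classical in
/-- `{i : ψ_i is connected to x - α in Γ_b}`. -/
noncomputable def component (b : AlgebraicClosure (RatFunc F)) : Finset (Fin D.r) :=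
  Finset.univ.filter fun i =>
    (gcdGraph D.ψ b).Reachable (Sum.inl i) (Sum.inl D.zeroIdx)

/-- The decomposition computed from an index set `I`: the normal `h ∈ F[x]` with
`h(x) - h(α) = ∏_{i ∈ I} ψ_i`, and `g` with `f = g ∘ h`. -/
noncomputable def fromIndices (I : Finset (Fin D.r)) : Option (F[X] × F[X]) := do
  let h ← compute fun h : F[X] => IsNormal h ∧ subAlpha h = ∏ i ∈ I, D.ψ i
  let g ← compute fun g : F[X] => f = g.comp h
  return (g, h)

/-- One pass of the loop over the nonlinear factors, for the root `b` of `ψ_ν`: it attaches one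
decomposition if `I_ν` is not the set of all indices, and nothing otherwise. -/
noncomputable def pass (b : AlgebraicClosure (RatFunc F)) : Option (List (F[X] × F[X])) :=
  if D.component b ≠ Finset.univ then do
    let p ← D.fromIndices (D.component b)
    return [p]
  else
    return []

end Factorization

/-- The algorithm `minDec`, run with the choices `D`.  The value is `some L` if no step fails and
the list `L` is returned, and `none` if a step fails. -/
noncomputable def minDec (f : F[X]) (D : Choices f) : Option (List (F[X] × F[X])) := do
  let L₁ ← D.linearPart
  let L₂ ← (List.finRange D.r).mapM fun ν : Fin D.r =>
    if hν : D.s ≤ (ν : ℕ) then D.pass (D.β ν hν) else return []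
  return L₁ ++ L₂.flatten

end Algorithm

end MinDec

/-!
Write `Z` for the set of roots of `f(x) - f(α)` in an algebraic closure of `F(α)`. Since `f' ≠ 0`,
these roots are simple (`separable_map_subAlpha`). Decompositions `f = g ∘ h` with `h` normal
correspond to the monic factors of `f(x) - f(α)` of the form `h(x) - h(α)`
(`subAlpha_dvd_iff`), that is, to the blocks of the Galois group that contain `α`. The proof works
with the factors directly and uses neither Galois groups nor Lüroth's theorem.

The main tool is `exists_subAlpha_eq`: a monic factor `P(x, α)` of `f(x) - f(α)` with `P(α, α) = 0`
has the form `h(x) - h(α)` as soon as `P(x, γ) = P(x, α)` for each of its roots `γ`. It is in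
`F[α][x]` by Gauss's lemma, and its total degree in `x` and `α` is its degree `m` in `x`
(`natDegree_coeff_le`). So the coefficient of a positive power of `x` is a polynomial in `α` of
degree less than `m` that takes one value at `m` points, and hence is constant.

For a root `β` of a nonlinear `ψ_ν`, the product `P` of the `ψ_i` connected to `x - α` in `Γ_β` is
also the product of the `ψ_j^*` connected to it (`map_prod_component`). The coefficients of `P` are
therefore in the intersection of `F(α)` and `F(β)`. An irreducible polynomial over one of these
fields divides each polynomial over that field with which it shares a root, so the property
`P(x, γ) = P(x, α)` of `γ` spreads along the edges of the graph (`aeval_eq_of_reachable`), and the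
criterion applies. The same argument, with the polynomial `h'` in place of the coefficients of `P`,
shows that `P` divides `h'(x) - h'(α)` whenever `f = g' ∘ h'` and `ψ_ν` divides `h'(x) - h'(α)`.
If `h'` is indecomposable, this forces `P = h'(x) - h'(α)` (`Factorization.pass_spec`).

In the remaining case `h'(x) - h'(α)` is a product of factors `x - γ` with `γ ∈ B_α`. The group `H`
acts regularly on `B_α`. The fibre `{γ ∈ B_α : h'(γ) = h'(α)}` is a block
(`Factorization.isBlock_fiber`), and each block containing `α` satisfies the criterion
(`Factorization.exists_subAlpha_eq_block`), so that the fibres of indecomposable `h'` are minimal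
blocks, or all of `B_α` if `H` is primitive (`Factorization.fiber_mem_atkinson`).
-/

namespace MinDec

/-! ### The bivariate polynomial `p(x) - p(y)` -/

section Bivariate

variable {F : Type*} [Field F]

/-- `p(x) - p(y)` as a polynomial in `x` with coefficients in `F[y]`. -/
noncomputable def biSub (p : F[X]) : F[X][X] :=
  p.map C - C p

lemma biSub_coeff_of_ne_zero (p : F[X]) {k : ℕ} (hk : k ≠ 0) :
    (biSub p).coeff k = C (p.coeff k) := by
  simp [biSub, coeff_C, hk]

lemma natDegree_biSub (p : F[X]) : (biSub p).natDegree = p.natDegree := by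
  rw [biSub, natDegree_sub_C, natDegree_map_eq_of_injective C_injective]

lemma monic_biSub {p : F[X]} (hp : p.Monic) (h0 : 0 < p.natDegree) : (biSub p).Monic := by
  have hm : (p.map (C : F →+* F[X])).Monic := hp.map C
  refine hm.sub_of_left (degree_C_le.trans_lt ?_)
  rw [← natDegree_pos_iff_degree_pos, natDegree_map_eq_of_injective C_injective]
  exact h0

@[simp] lemma eval_X_biSub (p : F[X]) : (biSub p).eval X = 0 := by
  simp [biSub, eval_map]

lemma biSub_comp_dvd (g h : F[X]) : biSub h ∣ biSub (g.comp h) := by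
  have key := sub_dvd_eval_sub (h.map C) (C h : F[X][X]) (g.map (C.comp C))
  have e₁ : (g.map (C.comp C)).eval (h.map C) = (g.comp h).map (C : F →+* F[X]) := by
    rw [map_comp, comp, eval₂_eq_eval_map, Polynomial.map_map]
  have e₂ : (g.map (C.comp C)).eval (C h : F[X][X]) = C (g.comp h) := by
    rw [eval_map, ← hom_eval₂, comp]
  rwa [e₁, e₂] at key

/-- The substitution `x ↦ x * y` in `F[y][x]`, with values in `F[x][y]`. It turns the total
degree of a polynomial into the degree of its image in the outer variable `y`. -/
noncomputable def scaleHom : F[X][X] →+* F[X][X] :=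
  eval₂RingHom (mapRingHom C) (C X * X)

lemma coeff_scaleHom (P : F[X][X]) (k l : ℕ) :
    ((scaleHom P).coeff (k + l)).coeff k = (P.coeff k).coeff l := by
  induction P using Polynomial.induction_on' with
  | add p q hp hq => simp [hp, hq]
  | monomial n c =>
    have e : scaleHom (monomial n c) = c.map C * C (X ^ n) * X ^ n := by
      simp [scaleHom, eval₂_monomial, mul_pow, mul_assoc]
    rw [e, coeff_mul_X_pow', coeff_monomial]
    by_cases hkn : n = k
    · subst hkn
      rw [if_pos (Nat.le_add_right _ _), if_pos rfl, Nat.add_sub_cancel_left, coeff_mul_C, coeff_map,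
        coeff_C_mul, coeff_X_pow_self, mul_one]
    · rw [if_neg hkn]
      split_ifs
      · rw [coeff_mul_C, coeff_map, coeff_C_mul, coeff_X_pow, if_neg (Ne.symm hkn), mul_zero,
          coeff_zero]
      · simp

lemma natDegree_scaleHom_biSub_le (f : F[X]) : (scaleHom (biSub f)).natDegree ≤ f.natDegree := by
  have e : scaleHom (biSub f) = (f.map C).comp (C X * X) - f.map C := by
    simp only [biSub, map_sub, scaleHom, coe_eval₂RingHom, eval₂_C, coe_mapRingHom]
    rw [eval₂_map, comp, eval₂_map]
    congr 2
    ext a : 1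
    simp
  rw [e]
  refine (natDegree_sub_le _ _).trans (max_le ?_ natDegree_map_le)
  refine natDegree_comp_le.trans ?_
  exact (Nat.mul_le_mul natDegree_map_le ((natDegree_C_mul_le _ _).trans natDegree_X_le)).trans
    (mul_one _).le

lemma natDegree_le_natDegree_scaleHom {P : F[X][X]} (hP : P.Monic) :
    P.natDegree ≤ (scaleHom P).natDegree := by
  refine le_natDegree_of_ne_zero fun h => ?_
  have := coeff_scaleHom P P.natDegree 0
  rw [add_zero, h, hP.coeff_natDegree] at this
  simp at this

/-- A factor of `f(x) - f(y)` that is monic in `x` has total degree equal to its degree in `x`: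
total degrees add up, and neither of two complementary factors has total degree smaller than its
degree in `x`. -/
lemma natDegree_coeff_le {f : F[X]} (hf : f.Monic) (hn : 0 < f.natDegree) {P : F[X][X]}
    (hP : P.Monic) (hd : P ∣ biSub f) (k : ℕ) :
    (P.coeff k).natDegree ≤ P.natDegree - k := by
  obtain ⟨Q, hQ⟩ := hd
  have hfm := monic_biSub hf hn
  have hQm : Q.Monic := hP.of_mul_monic_left (hQ ▸ hfm)
  have h1 := natDegree_scaleHom_biSub_le f
  have ne : ∀ {R : F[X][X]}, R.Monic → scaleHom R ≠ 0 := fun {R} hR h => by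
    have := coeff_scaleHom R R.natDegree 0
    rw [h, hR.coeff_natDegree] at this
    simp at this
  rw [hQ, map_mul, natDegree_mul (ne hP) (ne hQm)] at h1
  have h2 := congrArg natDegree hQ
  rw [natDegree_biSub, hP.natDegree_mul hQm] at h2
  have h3 := natDegree_le_natDegree_scaleHom hQm
  refine natDegree_le_iff_coeff_eq_zero.mpr fun l hl => ?_
  rw [← coeff_scaleHom, coeff_eq_zero_of_natDegree_lt (p := scaleHom P) (by omega), coeff_zero]

/-- If the coefficients of `P` at the positive powers of `x` are constants and `P(y, y) = 0`, then
`P = h(x) - h(y)` for a polynomial `h`. -/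
lemma exists_eq_biSub {P : F[X][X]} (hP : P.Monic) (hX : P.eval X = 0)
    (hc : ∀ k ≠ 0, (P.coeff k).natDegree = 0) : ∃ h : F[X], IsNormal h ∧ biSub h = P := by
  have hpos : 0 < P.natDegree := by
    rcases Nat.eq_zero_or_pos P.natDegree with h | h
    · rw [hP.natDegree_eq_zero.mp h] at hX
      simp at hX
    · exact h
  set p₀ := P.map (evalRingHom (0 : F)) with hp₀
  have hp₀m : p₀.Monic := hP.map _
  have hdeg : p₀.natDegree = P.natDegree := hP.natDegree_map _
  set h := p₀ - C (p₀.coeff 0) with hh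
  refine ⟨h, ⟨hp₀m.sub_of_left (degree_C_le.trans_lt ?_), ?_⟩, ?_⟩
  · rwa [← natDegree_pos_iff_degree_pos, hdeg]
  · rw [← coeff_zero_eq_eval_zero]
    simp [hh]
  · have hcoeff : ∀ k ≠ 0, (biSub h).coeff k = P.coeff k := by
      intro k hk
      rw [biSub_coeff_of_ne_zero _ hk, hh, coeff_sub, coeff_C, if_neg hk, sub_zero, hp₀, coeff_map,
        coe_evalRingHom, ← coeff_zero_eq_eval_zero]
      exact (eq_C_of_natDegree_eq_zero (hc k hk)).symm
    have hdiff : P - biSub h = C ((P - biSub h).coeff 0) := by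
      ext1 k
      by_cases hk : k = 0
      · simp [hk]
      · rw [coeff_sub, hcoeff k hk, sub_self, coeff_C, if_neg hk]
    have h0 := congrArg (eval X) hdiff
    rw [eval_sub, hX, eval_X_biSub, sub_zero, eval_C] at h0
    rw [← h0, C_0, sub_eq_zero] at hdiff
    exact hdiff.symm

/-- `h(x) - h(y)` divides `f(x) - f(y)` only if `f` is a polynomial in `h`. Setting `y = 0` gives
`f = f(0) + h * q`, where `h(x) - h(y)` divides `q(x) - q(y)` as well. -/
lemma exists_eq_comp_of_biSub_dvd {h : F[X]} (hh : IsNormal h) (hpos : 0 < h.natDegree)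
    (f : F[X]) (hd : biSub h ∣ biSub f) : ∃ g : F[X], f = g.comp h := by
  induction hn : f.natDegree using Nat.strong_induction_on generalizing f with
  | _ n ih =>
    by_cases hf0 : f.natDegree = 0
    · exact ⟨f, by rw [eq_C_of_natDegree_eq_zero hf0, C_comp]⟩
    have h0 : ∀ p : F[X], (biSub p).map (evalRingHom (0 : F)) = p - C (p.eval 0) := by
      intro p
      have e : (evalRingHom (0 : F)).comp C = RingHom.id F := by ext; simp
      simp [biSub, Polynomial.map_map, e]
    obtain ⟨q, hq⟩ := Polynomial.map_dvd (evalRingHom (0 : F)) hd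
    rw [h0, h0, hh.2, C_0, sub_zero] at hq
    have hfq : f = C (f.eval 0) + h * q := by rw [← hq]; ring
    have hq0 : q ≠ 0 := by
      rintro rfl
      rw [mul_zero, add_zero] at hfq
      exact hf0 (hfq ▸ natDegree_C _)
    have hdeg : f.natDegree = h.natDegree + q.natDegree := by
      rw [← natDegree_mul hh.1.ne_zero hq0, ← hq, natDegree_sub_C]
    have hbi : biSub f = biSub h * q.map C + C h * biSub q := by
      have : biSub f = biSub (C (f.eval 0) + h * q) := by rw [← hfq]
      rw [this]
      simp only [biSub, Polynomial.map_add, Polynomial.map_mul, map_C, C_add, C_mul]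
      ring
    have hm := monic_biSub hh.1 hpos
    have hdq : biSub h ∣ C h * biSub q := by
      rw [hbi] at hd
      exact (dvd_add_right (dvd_mul_right _ _)).mp hd
    rw [← modByMonic_eq_zero_iff_dvd hm, ← smul_eq_C_mul, smul_modByMonic, smul_eq_zero,
      modByMonic_eq_zero_iff_dvd hm] at hdq
    obtain ⟨g, hg⟩ := ih q.natDegree (by omega) q (hdq.resolve_left hh.1.ne_zero) rfl
    refine ⟨C (f.eval 0) + X * g, ?_⟩
    rw [add_comp, mul_comp, C_comp, X_comp, ← hg]
    exact hfq

end Bivariate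

/-! ### Substituting conjugates of `α` -/

section Substitution

variable {F : Type*} [Field F]

lemma natDegree_pos_of_derivative_ne_zero {f : F[X]} (hf' : derivative f ≠ 0) :
    0 < f.natDegree :=
  Nat.pos_of_ne_zero fun h => hf' (by rw [eq_C_of_natDegree_eq_zero h, derivative_C])

lemma atAlpha_eq (p : F[X]) : atAlpha p = algebraMap F[X] (RatFunc F) p := by
  rw [atAlpha, ← RatFunc.algebraMap_eq_C, ← aeval_def, RatFunc.aeval_X_left_eq_algebraMap]

lemma atAlpha_injective : Function.Injective (atAlpha (F := F)) := fun p q h => by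
  rw [atAlpha_eq, atAlpha_eq] at h
  exact RatFunc.algebraMap_injective F h

lemma atAlpha_comp (p q : F[X]) : atAlpha (p.comp q) = p.eval₂ RatFunc.C (atAlpha q) :=
  eval₂_comp _

lemma subAlpha_eq_map (p : F[X]) :
    subAlpha p = (biSub p).map (algebraMap F[X] (RatFunc F)) := by
  rw [subAlpha, biSub, Polynomial.map_sub, Polynomial.map_map, map_C, atAlpha_eq,
    ← RatFunc.algebraMap_comp_C]

lemma natDegree_subAlpha (p : F[X]) : (subAlpha p).natDegree = p.natDegree := by
  rw [subAlpha_eq_map, natDegree_map_eq_of_injective (RatFunc.algebraMap_injective F),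
    natDegree_biSub]

lemma monic_subAlpha {p : F[X]} (hp : p.Monic) (h0 : 0 < p.natDegree) : (subAlpha p).Monic := by
  rw [subAlpha_eq_map]
  exact (monic_biSub hp h0).map _

lemma eval_subAlpha (p : F[X]) (c : RatFunc F) :
    (subAlpha p).eval c = p.eval₂ RatFunc.C c - atAlpha p := by
  rw [subAlpha, eval_sub, eval_map, eval_C]

@[simp] lemma eval_X_subAlpha (p : F[X]) : (subAlpha p).eval RatFunc.X = 0 := by
  rw [eval_subAlpha, atAlpha, sub_self]

/-- A normal polynomial `p` is determined by `p(x) - p(α)`. -/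
lemma IsNormal.ext {p q : F[X]} (hp : IsNormal p) (hq : IsNormal q)
    (h : subAlpha p = subAlpha q) : p = q := by
  rw [subAlpha_eq_map, subAlpha_eq_map] at h
  have h := map_injective _ (RatFunc.algebraMap_injective F) h
  ext k
  by_cases hk : k = 0
  · rw [hk, coeff_zero_eq_eval_zero, coeff_zero_eq_eval_zero, hp.2, hq.2]
  · have := congrArg (fun P => P.coeff k) h
    rw [biSub_coeff_of_ne_zero _ hk, biSub_coeff_of_ne_zero _ hk] at this
    exact C_injective this

lemma subAlpha_dvd_iff_biSub_dvd {p q : F[X]} (hp : p.Monic) (h0 : 0 < p.natDegree) :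
    subAlpha p ∣ subAlpha q ↔ biSub p ∣ biSub q := by
  rw [subAlpha_eq_map, subAlpha_eq_map,
    Polynomial.map_dvd_map _ (RatFunc.algebraMap_injective F) (monic_biSub hp h0)]

/-- Over `F(α)`, the polynomial `h(x) - h(α)` divides `f(x) - f(α)` if and only if `f` is a
polynomial in `h`. -/
lemma subAlpha_dvd_iff {h : F[X]} (hh : IsNormal h) (h0 : 0 < h.natDegree) (f : F[X]) :
    subAlpha h ∣ subAlpha f ↔ ∃ g : F[X], f = g.comp h := by
  rw [subAlpha_dvd_iff_biSub_dvd hh.1 h0]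
  exact ⟨exists_eq_comp_of_biSub_dvd hh h0 f, fun ⟨g, hg⟩ => hg ▸ biSub_comp_dvd g h⟩

/-- A monic factor of `f(x) - f(α)` over `F(α)` has coefficients in `F[α]`, because `F[α]` is
integrally closed. -/
lemma exists_lift_of_dvd_subAlpha {f : F[X]} (hf : f.Monic) (hn : 0 < f.natDegree)
    {P : (RatFunc F)[X]} (hP : P.Monic) (hd : P ∣ subAlpha f) :
    ∃ P' : F[X][X], P'.Monic ∧ P' ∣ biSub f ∧ P'.map (algebraMap F[X] (RatFunc F)) = P := by
  rw [subAlpha_eq_map] at hd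
  obtain ⟨P', hP'⟩ := IsIntegrallyClosed.eq_map_mul_C_of_dvd (RatFunc F) (monic_biSub hf hn) hd
  rw [hP.leadingCoeff, C_1, mul_one] at hP'
  have hinj := RatFunc.algebraMap_injective F
  have hm : P'.Monic := by
    rw [← hP'] at hP
    exact monic_of_injective hinj hP
  refine ⟨P', hm, ?_, hP'⟩
  rwa [← hP', Polynomial.map_dvd_map _ hinj hm] at hd

/-- The algebraic closure of the rational function field. -/
abbrev Closure (F : Type*) [Field F] : Type _ := AlgebraicClosure (RatFunc F)

/-- The element `α`, seen in the algebraic closure of `F(α)`. -/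
noncomputable def alphaBar (F : Type*) [Field F] : Closure F :=
  algebraMap (RatFunc F) (Closure F) RatFunc.X

lemma transcendental_alphaBar : Transcendental F (alphaBar F) := by
  rw [alphaBar, transcendental_algebraMap_iff (algebraMap (RatFunc F) (Closure F)).injective]
  exact RatFunc.transcendental_X

lemma aeval_alphaBar (p : F[X]) :
    aeval (alphaBar F) p = algebraMap (RatFunc F) (Closure F) (atAlpha p) := by
  rw [alphaBar, aeval_algebraMap_apply, atAlpha, ← RatFunc.algebraMap_eq_C, ← aeval_def]

/-- The conjugates of `α` over `F(f(α))` are transcendental over `F`. -/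
lemma transcendental_of_aeval_eq {f : F[X]} (hn : 0 < f.natDegree) {γ : Closure F}
    (hγ : aeval γ f = aeval (alphaBar F) f) : Transcendental F γ := by
  have h : Transcendental F (aeval (alphaBar F) f) :=
    transcendental_alphaBar.aeval f hn.ne' (mem_nonZeroDivisors_of_ne_zero
      (leadingCoeff_ne_zero.mpr (ne_zero_of_natDegree_gt hn)))
  rw [← hγ] at h
  intro ha
  have hi := isAlgebraic_iff_isIntegral.mp ha
  refine h (isAlgebraic_iff_isIntegral.mpr ?_)
  exact Algebra.adjoin_le (S := integralClosure F (Closure F)) (Set.singleton_subset_iff.mpr hi)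
    (aeval_mem_adjoin_singleton F γ)

/-- The embedding of `F(α)` into its algebraic closure that sends `α` to a transcendental `γ`. -/
noncomputable def evalHom {γ : Closure F} (hγ : Transcendental F γ) : RatFunc F →ₐ[F] Closure F :=
  RatFunc.liftAlgHom (aeval γ)
    (nonZeroDivisors_le_comap_nonZeroDivisors_of_injective _
      (transcendental_iff_injective.mp hγ))

lemma evalHom_algebraMap {γ : Closure F} (hγ : Transcendental F γ) (p : F[X]) :
    evalHom hγ (algebraMap F[X] (RatFunc F) p) = aeval γ p := by
  have := RatFunc.liftAlgHom_apply_div (aeval γ)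
    (nonZeroDivisors_le_comap_nonZeroDivisors_of_injective _
      (transcendental_iff_injective.mp hγ)) p 1
  rwa [map_one, div_one, map_one, div_one] at this

lemma substAlpha_eq_map {γ : Closure F} (hγ : Transcendental F γ) (p : (RatFunc F)[X]) :
    substAlpha γ p = p.map (evalHom hγ : RatFunc F →+* Closure F) := by
  have h : ∀ c : RatFunc F,
      c.eval ((algebraMap (RatFunc F) (Closure F)).comp RatFunc.C) γ = evalHom hγ c := by
    intro c
    rw [evalHom, RatFunc.liftAlgHom_apply, RatFunc.eval, ← RatFunc.algebraMap_eq_C,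
      ← IsScalarTower.algebraMap_eq, ← aeval_def, ← aeval_def]
  rw [substAlpha, map, eval₂_eq_sum, sum_def, sum_def]
  refine Finset.sum_congr rfl fun k _ => ?_
  rw [RingHom.comp_apply, C_mul_X_pow_eq_monomial]
  exact congrArg _ (h _)

lemma evalHom_atAlpha {γ : Closure F} (hγ : Transcendental F γ) (p : F[X]) :
    evalHom hγ (atAlpha p) = aeval γ p := by
  rw [atAlpha_eq, evalHom_algebraMap]

lemma map_evalHom_subAlpha {γ : Closure F} (hγ : Transcendental F γ) (p : F[X]) :
    (subAlpha p).map (evalHom hγ : RatFunc F →+* Closure F) =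
      p.map (algebraMap F (Closure F)) - C (aeval γ p) := by
  rw [subAlpha, Polynomial.map_sub, Polynomial.map_map, map_C, ← RatFunc.algebraMap_eq_C,
    AlgHom.comp_algebraMap, RingHom.coe_coe, evalHom_atAlpha]

lemma map_subAlpha (p : F[X]) :
    (subAlpha p).map (algebraMap (RatFunc F) (Closure F)) =
      p.map (algebraMap F (Closure F)) - C (aeval (alphaBar F) p) := by
  rw [subAlpha, Polynomial.map_sub, Polynomial.map_map, map_C, ← RatFunc.algebraMap_eq_C,
    ← IsScalarTower.algebraMap_eq, aeval_alphaBar]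

lemma aeval_subAlpha (p : F[X]) (γ : Closure F) :
    aeval γ (subAlpha p) = aeval γ p - aeval (alphaBar F) p := by
  rw [← eval_map_algebraMap, map_subAlpha, eval_sub, eval_C, eval_map_algebraMap]

lemma aeval_subAlpha_eq_zero_iff {p : F[X]} {γ : Closure F} :
    aeval γ (subAlpha p) = 0 ↔ aeval γ p = aeval (alphaBar F) p := by
  rw [aeval_subAlpha, sub_eq_zero]

/-- A common root of `f(x) - f(α)` and `f'` would be algebraic over `F` by the latter, but is
transcendental by the former. -/
lemma separable_map_subAlpha {f : F[X]} (hf' : derivative f ≠ 0) :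
    ((subAlpha f).map (algebraMap (RatFunc F) (Closure F))).Separable := by
  have hn := natDegree_pos_of_derivative_ne_zero hf'
  rw [separable_def, isCoprime_iff_aeval_ne_zero_of_isAlgClosed (Closure F) (Closure F)]
  intro γ
  by_contra! h
  obtain ⟨h₁, h₂⟩ := h
  rw [coe_aeval_eq_eval, eval_map_algebraMap, aeval_subAlpha_eq_zero_iff] at h₁
  rw [map_subAlpha, derivative_sub, derivative_C, sub_zero, derivative_map, coe_aeval_eq_eval,
    eval_map_algebraMap] at h₂
  exact transcendental_of_aeval_eq hn h₁ ⟨_, hf', h₂⟩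

/-- Over an algebraically closed field, monic divisors of a separable polynomial are determined by
their roots. -/
lemma eq_of_dvd_separable {L : Type*} [Field L] [IsAlgClosed L] {s p q : L[X]} (hs : s.Separable)
    (hp : p.Monic) (hq : q.Monic) (hps : p ∣ s) (hqs : q ∣ s)
    (h : ∀ γ, p.eval γ = 0 ↔ q.eval γ = 0) : p = q := by
  have key : p.roots = q.roots :=
    (Multiset.Nodup.ext (nodup_roots (hs.of_dvd hps)) (nodup_roots (hs.of_dvd hqs))).mpr fun γ => by
      rw [mem_roots hp.ne_zero, mem_roots hq.ne_zero, IsRoot, IsRoot, h]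
  rw [(IsAlgClosed.splits p).eq_prod_roots_of_monic hp,
    (IsAlgClosed.splits q).eq_prod_roots_of_monic hq, key]

/-- An irreducible polynomial that, after some field embedding, has a root in common with another
polynomial divides that polynomial. -/
lemma dvd_of_common_root {K L : Type*} [Field K] [Field L] (φ : K →+* L) {p q : K[X]}
    (hp : Irreducible p) {γ : L} (h₁ : (p.map φ).eval γ = 0) (h₂ : (q.map φ).eval γ = 0) :
    p ∣ q := by
  by_contra h
  obtain ⟨a, b, hab⟩ := (hp.coprime_iff_not_dvd.mpr h).map (mapRingHom φ)
  have := congrArg (eval γ) hab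
  simp [h₁, h₂] at this

/-- Whether `c(γ) = d`, with `c ∈ F[x]` and `d ∈ F(α)`, does not depend on the choice of the root
`γ` of an irreducible polynomial over `F(α)`. -/
lemma aeval_eq_of_common_root {φ : RatFunc F →ₐ[F] Closure F} {p : (RatFunc F)[X]}
    (hp : Irreducible p) {γ γ' : Closure F} (hγ : (p.map (φ : RatFunc F →+* Closure F)).eval γ = 0)
    (hγ' : (p.map (φ : RatFunc F →+* Closure F)).eval γ' = 0) {c : F[X]} {d : RatFunc F}
    (h : aeval γ c = φ d) : aeval γ' c = φ d := by
  have e : ∀ δ : Closure F, ((c.map RatFunc.C - C d).map (φ : RatFunc F →+* Closure F)).eval δ =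
      aeval δ c - φ d := by
    intro δ
    rw [Polynomial.map_sub, Polynomial.map_map, map_C, ← RatFunc.algebraMap_eq_C,
      AlgHom.comp_algebraMap, RingHom.coe_coe, eval_sub, eval_C, eval_map_algebraMap]
  obtain ⟨r, hr⟩ := dvd_of_common_root _ hp hγ ((e γ).trans (sub_eq_zero.mpr h))
  rw [← sub_eq_zero, ← e, hr, Polynomial.map_mul, eval_mul, hγ', zero_mul]

/-- The criterion that replaces the correspondence between blocks and intermediate fields: a monic
factor of `f(x) - f(α)` that vanishes at `α` and is unchanged when any of its roots is substituted
for `α` has the form `h(x) - h(α)`. Indeed, let `m` be its degree. The coefficients of the positive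
powers of `x` are polynomials in `α` of degree less than `m` taking the same value at all of the
`m` roots, so they are constant. -/
theorem exists_subAlpha_eq {f : F[X]} (hf : f.Monic) (hf' : derivative f ≠ 0)
    {P : (RatFunc F)[X]} (hP : P.Monic) (hd : P ∣ subAlpha f) (hX : P.eval RatFunc.X = 0)
    (hS : ∀ γ : Closure F, aeval γ P = 0 → ∀ hγ : Transcendental F γ, ∀ k,
      evalHom hγ (P.coeff k) = algebraMap (RatFunc F) (Closure F) (P.coeff k)) :
    ∃ h : F[X], IsNormal h ∧ subAlpha h = P := by
  classical
  have hn := natDegree_pos_of_derivative_ne_zero hf'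
  obtain ⟨P', hP', hd', rfl⟩ := exists_lift_of_dvd_subAlpha hf hn hP hd
  have hinj := RatFunc.algebraMap_injective F
  have hX' : P'.eval X = 0 := by
    rw [← RatFunc.algebraMap_X, eval_map_apply] at hX
    exact hinj (hX.trans (map_zero _).symm)
  obtain ⟨h, hh, rfl⟩ := exists_eq_biSub hP' hX' fun k hk => by
    set PΩ := (P'.map (algebraMap F[X] (RatFunc F))).map (algebraMap (RatFunc F) (Closure F))
      with hPΩ
    have hPΩm : PΩ.Monic := hP.map _
    have hsep : PΩ.Separable :=
      (separable_map_subAlpha hf').of_dvd (Polynomial.map_dvd _ hd)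
    have hcard : PΩ.roots.toFinset.card = P'.natDegree := by
      rw [Multiset.toFinset_card_of_nodup (nodup_roots hsep),
        ← (IsAlgClosed.splits PΩ).natDegree_eq_card_roots, hPΩ, natDegree_map, hP'.natDegree_map]
    have hpos : 0 < P'.natDegree := by
      rcases Nat.eq_zero_or_pos P'.natDegree with h | h
      · rw [hP'.natDegree_eq_zero.mp h] at hX'
        simp at hX'
      · exact h
    set c := P'.coeff k with hc
    have hdeg : c.natDegree < P'.natDegree :=
      (natDegree_coeff_le hf hn hP' hd' k).trans_lt (by omega)
    have hzero : c.map (algebraMap F (Closure F)) - C (aeval (alphaBar F) c) = 0 := by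
      refine eq_zero_of_natDegree_lt_card_of_eval_eq_zero' _ PΩ.roots.toFinset ?_ ?_
      · intro γ hγ
        rw [Multiset.mem_toFinset, mem_roots hPΩm.ne_zero, IsRoot, hPΩ, eval_map_algebraMap] at hγ
        have hγt : Transcendental F γ := by
          obtain ⟨Q, hQ⟩ := hd
          refine transcendental_of_aeval_eq hn (aeval_subAlpha_eq_zero_iff.mp ?_)
          rw [hQ, map_mul, hγ, zero_mul]
        have := hS γ hγ hγt k
        rw [coeff_map, ← hc, evalHom_algebraMap, ← atAlpha_eq, ← aeval_alphaBar] at this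
        rw [eval_sub, eval_C, eval_map_algebraMap, this, sub_self]
      · rwa [natDegree_sub_C, natDegree_map, hcard]
    rw [sub_eq_zero] at hzero
    rw [← natDegree_map (algebraMap F (Closure F)), hzero, natDegree_C]
  exact ⟨h, hh, subAlpha_eq_map h⟩

end Substitution

/-! ### Decompositions and computations that cannot fail -/

section Auxiliary

variable {F : Type*} [Field F]

lemma compute_eq_some {A : Type*} {P : A → Prop} {a : A} (ha : P a) (h : ∀ b, P b → b = a) :
    compute P = some a := by
  have hex : ∃ a, P a := ⟨a, ha⟩
  rw [compute, dif_pos hex, h _ hex.choose_spec]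

lemma comp_left_injective {h : F[X]} (h0 : 0 < h.natDegree) {g₁ g₂ : F[X]}
    (e : g₁.comp h = g₂.comp h) : g₁ = g₂ := by
  rw [← sub_eq_zero, ← sub_comp, comp_eq_zero_iff] at e
  rcases e with e | ⟨-, e⟩
  · exact sub_eq_zero.mp e
  · rw [e, natDegree_C] at h0
    exact absurd h0 (lt_irrefl 0)

lemma isDecomposition_of_comp {f g h : F[X]} (hfg : f = g.comp h) (h2 : 2 ≤ h.natDegree)
    (hlt : h.natDegree < f.natDegree) : IsDecomposition f g h := by
  refine ⟨?_, h2, hfg⟩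
  rw [hfg, natDegree_comp] at hlt
  by_contra! hg
  interval_cases g.natDegree <;> omega

lemma IsDecomposition.natDegree_lt {f g h : F[X]} (hd : IsDecomposition f g h) :
    h.natDegree < f.natDegree := by
  rw [hd.2.2, natDegree_comp]
  nlinarith [hd.1, hd.2.1]

/-- An indecomposable normal `p` such that `p(x) - p(α)` is divisible by `h(x) - h(α)`, with
`deg h ≥ 2`, is equal to `h`. -/
lemma IsIndecomposable.eq_of_dvd {p h : F[X]} (hp : IsIndecomposable p) (hpn : IsNormal p)
    (hp2 : 2 ≤ p.natDegree) (hh : IsNormal h) (h2 : 2 ≤ h.natDegree)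
    (hd : subAlpha h ∣ subAlpha p) : h = p := by
  obtain ⟨g, hg⟩ := (subAlpha_dvd_iff hh (by omega) p).mp hd
  have hle : p.natDegree ≤ h.natDegree := by
    by_contra! hlt
    exact hp ⟨g, h, isDecomposition_of_comp hg h2 hlt⟩
  refine hh.ext hpn (eq_of_monic_of_dvd_of_natDegree_le (monic_subAlpha hh.1 (by omega))
    (monic_subAlpha hpn.1 (by omega)) hd ?_).symm
  rwa [natDegree_subAlpha, natDegree_subAlpha]

lemma natDegree_eq_one_of_comp_eq {f : F[X]} (hn : 0 < f.natDegree) {l : F[X]} (hl : f.comp l = f) :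
    l.natDegree = 1 := by
  have := congrArg natDegree hl
  rw [natDegree_comp] at this
  exact Nat.eq_of_mul_eq_mul_left hn (by rw [this, mul_one])

lemma eval₂_injective {l : F[X]} (hl : l.natDegree = 1) :
    Function.Injective fun c : RatFunc F => l.eval₂ RatFunc.C c := by
  obtain ⟨a, ha, b, rfl⟩ := natDegree_eq_one.mp hl
  intro c d h
  simpa [ha] using h

/-- The roots of `f(x) - f(α)` in `F(α)` are values of linear polynomials at `α`. -/
lemma exists_linear {f : F[X]} (hf : f.Monic) (hn : 0 < f.natDegree) {c : RatFunc F}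
    (hc : (subAlpha f).eval c = 0) :
    ∃ l : F[X], l.natDegree = 1 ∧ atAlpha l = c ∧ f.comp l = f := by
  obtain ⟨P', -, -, hP'⟩ :=
    exists_lift_of_dvd_subAlpha hf hn (monic_X_sub_C c) (dvd_iff_isRoot.mpr hc)
  have h0 : atAlpha (-P'.coeff 0) = c := by
    have := congrArg (fun p => p.coeff 0) hP'
    simp only [coeff_map, coeff_sub, coeff_X_zero, coeff_C_zero, zero_sub] at this
    rw [atAlpha_eq, map_neg, this, neg_neg]
  have hcomp : f.comp (-P'.coeff 0) = f := by
    apply atAlpha_injective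
    rw [atAlpha_comp, h0, ← sub_eq_zero, ← eval_subAlpha, hc]
  exact ⟨_, natDegree_eq_one_of_comp_eq hn hcomp, h0, hcomp⟩

end Auxiliary

/-! ### Irreducible factors of `f(x) - f(α)` -/

namespace Factorization

variable {F : Type*} [Field F] {f : F[X]} (D : Factorization f)

lemma ψ_zeroIdx : D.ψ D.zeroIdx = X - C RatFunc.X := by
  rw [← D.root_zero]
  exact D.ψ_linear ⟨0, D.s_pos⟩

lemma monic_prod (I : Finset (Fin D.r)) : (∏ i ∈ I, D.ψ i).Monic :=
  monic_prod_of_monic _ _ fun i _ => D.monic i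

lemma prod_dvd (I : Finset (Fin D.r)) : ∏ i ∈ I, D.ψ i ∣ subAlpha f := by
  rw [← D.prod_eq]
  exact Finset.prod_dvd_prod_of_subset _ _ _ (Finset.subset_univ I)

lemma ψ_dvd (i : Fin D.r) : D.ψ i ∣ subAlpha f := by
  rw [← D.prod_eq]
  exact Finset.dvd_prod_of_mem _ (Finset.mem_univ i)

lemma eval_prod_map_eq_zero_iff {L : Type*} [Field L] (φ : RatFunc F →+* L)
    (I : Finset (Fin D.r)) (γ : L) :
    ((∏ i ∈ I, D.ψ i).map φ).eval γ = 0 ↔ ∃ i ∈ I, ((D.ψ i).map φ).eval γ = 0 := by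
  rw [Polynomial.map_prod, eval_prod, Finset.prod_eq_zero_iff]

lemma exists_root_index {L : Type*} [Field L] (φ : RatFunc F →+* L) {γ : L}
    (h : ((subAlpha f).map φ).eval γ = 0) : ∃ i, ((D.ψ i).map φ).eval γ = 0 := by
  rw [← D.prod_eq, eval_prod_map_eq_zero_iff] at h
  exact h.imp fun i hi => hi.2

lemma eq_of_common_root (hf' : derivative f ≠ 0) {L : Type*} [Field L] (φ : RatFunc F →+* L)
    {γ : L} {i j : Fin D.r} (hi : ((D.ψ i).map φ).eval γ = 0)
    (hj : ((D.ψ j).map φ).eval γ = 0) : i = j := by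
  by_contra hne
  have hd : D.ψ i * D.ψ j ∣ subAlpha f := by
    rw [← Finset.prod_pair hne]
    exact D.prod_dvd _
  have hsep : (subAlpha f).Separable := separable_map _ |>.mp (separable_map_subAlpha hf')
  obtain ⟨a, b, hab⟩ := (hsep.of_dvd hd).isCoprime.map (mapRingHom φ)
  have := congrArg (eval γ) hab
  simp [hi, hj] at this

lemma exists_root (i : Fin D.r) :
    ∃ γ : Closure F, ((D.ψ i).map (algebraMap (RatFunc F) (Closure F))).eval γ = 0 :=
  IsAlgClosed.exists_root _ (by
    rw [degree_map]
    exact (degree_pos_of_irreducible (D.irreducible i)).ne')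

open Classical in
lemma prod_filter_dvd (hf' : derivative f ≠ 0) {P : (RatFunc F)[X]} (hP : P.Monic)
    (hd : P ∣ subAlpha f) : ∏ i with D.ψ i ∣ P, D.ψ i = P := by
  apply map_injective _ (algebraMap (RatFunc F) (Closure F)).injective
  refine eq_of_dvd_separable (separable_map_subAlpha hf') ((D.monic_prod _).map _) (hP.map _)
    (Polynomial.map_dvd _ (D.prod_dvd _)) (Polynomial.map_dvd _ hd) fun γ => ?_
  rw [eval_prod_map_eq_zero_iff]
  constructor
  · rintro ⟨i, hi, hγ⟩
    obtain ⟨Q, hQ⟩ := (Finset.mem_filter.mp hi).2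
    rw [hQ, Polynomial.map_mul, eval_mul, hγ, zero_mul]
  · intro hγ
    obtain ⟨Q, hQ⟩ := hd
    obtain ⟨i, hi⟩ := D.exists_root_index (algebraMap (RatFunc F) (Closure F)) (γ := γ) (by
      rw [hQ, Polynomial.map_mul, eval_mul, hγ, zero_mul])
    exact ⟨i, Finset.mem_filter.mpr ⟨Finset.mem_univ i, dvd_of_common_root _ (D.irreducible i) hi hγ⟩,
      hi⟩

lemma fromIndices_eq_some {I : Finset (Fin D.r)} {g h : F[X]} (hh : IsNormal h)
    (h0 : 0 < h.natDegree) (hI : subAlpha h = ∏ i ∈ I, D.ψ i) (hg : f = g.comp h) :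
    D.fromIndices I = some (g, h) := by
  have e₁ : (compute fun h : F[X] => IsNormal h ∧ subAlpha h = ∏ i ∈ I, D.ψ i) = some h :=
    compute_eq_some ⟨hh, hI⟩ fun p hp => hp.1.ext hh (hp.2.trans hI.symm)
  have e₂ : (compute fun g : F[X] => f = g.comp h) = some g :=
    compute_eq_some hg fun p hp => comp_left_injective h0 (hp.symm.trans hg)
  simp [fromIndices, e₁, e₂]

/-! ### The graphs `Γ_β` -/

/-- The polynomial over the algebraic closure of `F(α)` that belongs to a vertex of `Γ_b`: `ψ_i` or
`ψ_i^*`. -/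
noncomputable def vertexPoly {b : Closure F} (hb : Transcendental F b) :
    Fin D.r ⊕ Fin D.r → (Closure F)[X] :=
  Sum.elim (fun i => (D.ψ i).map (algebraMap (RatFunc F) (Closure F)))
    (fun j => (D.ψ j).map (evalHom hb : RatFunc F →+* Closure F))

lemma exists_common_root_of_adj {b : Closure F} (hb : Transcendental F b)
    {v w : Fin D.r ⊕ Fin D.r} (h : (gcdGraph D.ψ b).Adj v w) :
    ∃ γ, (D.vertexPoly hb v).eval γ = 0 ∧ (D.vertexPoly hb w).eval γ = 0 := by
  have key : ∀ i j : Fin D.r,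
      ¬ IsCoprime ((D.ψ i).map (algebraMap (RatFunc F) (Closure F))) (substAlpha b (D.ψ j)) →
      ∃ γ, (D.vertexPoly hb (Sum.inl i)).eval γ = 0 ∧ (D.vertexPoly hb (Sum.inr j)).eval γ = 0 := by
    intro i j hij
    rw [substAlpha_eq_map hb,
      isCoprime_iff_aeval_ne_zero_of_isAlgClosed (Closure F) (Closure F)] at hij
    push Not at hij
    exact hij
  rw [gcdGraph, SimpleGraph.fromRel_adj] at h
  rcases h.2 with ⟨i, j, rfl, rfl, hij⟩ | ⟨i, j, rfl, rfl, hij⟩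
  · exact key i j hij
  · exact (key i j hij).imp fun γ hγ => hγ.symm

lemma adj_of_common_root {b : Closure F} (hb : Transcendental F b) {i j : Fin D.r} {γ : Closure F}
    (hi : (D.vertexPoly hb (Sum.inl i)).eval γ = 0)
    (hj : (D.vertexPoly hb (Sum.inr j)).eval γ = 0) :
    (gcdGraph D.ψ b).Adj (Sum.inl i) (Sum.inr j) := by
  rw [gcdGraph, SimpleGraph.fromRel_adj]
  refine ⟨Sum.inl_ne_inr, Or.inl ⟨i, j, rfl, rfl, ?_⟩⟩
  rw [substAlpha_eq_map hb, isCoprime_iff_aeval_ne_zero_of_isAlgClosed (Closure F) (Closure F)]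
  push Not
  exact ⟨γ, hi, hj⟩

/-- If `c(α)`, with `c ∈ F[x]`, lies in the images of both embeddings of `F(α)`, then `c` takes the
same value at all roots of the polynomials connected to `x - α` in `Γ_b`. -/
lemma aeval_eq_of_reachable {b : Closure F} (hb : Transcendental F b) {c : F[X]} {d : RatFunc F}
    (hd : evalHom hb d = aeval (alphaBar F) c) {v : Fin D.r ⊕ Fin D.r}
    (hv : (gcdGraph D.ψ b).Reachable (Sum.inl D.zeroIdx) v) :
    ∀ γ, (D.vertexPoly hb v).eval γ = 0 → aeval γ c = aeval (alphaBar F) c := by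
  rw [SimpleGraph.reachable_iff_reflTransGen] at hv
  induction hv with
  | refl =>
    intro γ hγ
    rw [vertexPoly, Sum.elim_inl, ψ_zeroIdx, Polynomial.map_sub, map_X, map_C, eval_sub, eval_X,
      eval_C, sub_eq_zero] at hγ
    rw [hγ, alphaBar]
  | @tail v w _ hvw ih =>
    intro γ hγ
    obtain ⟨δ, hδv, hδw⟩ := D.exists_common_root_of_adj hb hvw
    have hδ := ih δ hδv
    cases w with
    | inl i =>
      rw [aeval_alphaBar] at hδ ⊢
      exact aeval_eq_of_common_root (φ := IsScalarTower.toAlgHom F (RatFunc F) (Closure F))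
        (D.irreducible i) hδw hγ hδ
    | inr j =>
      rw [← hd] at hδ ⊢
      exact aeval_eq_of_common_root (D.irreducible j) hδw hγ hδ

open Classical in
/-- `{j : ψ_j^* is connected to x - α in Γ_b}`. -/
noncomputable def starComponent (b : Closure F) : Finset (Fin D.r) :=
  Finset.univ.filter fun j => (gcdGraph D.ψ b).Reachable (Sum.inr j) (Sum.inl D.zeroIdx)

lemma mem_component {b : Closure F} {i : Fin D.r} :
    i ∈ D.component b ↔ (gcdGraph D.ψ b).Reachable (Sum.inl i) (Sum.inl D.zeroIdx) := by
  simp [component]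

lemma mem_starComponent {b : Closure F} {j : Fin D.r} :
    j ∈ D.starComponent b ↔ (gcdGraph D.ψ b).Reachable (Sum.inr j) (Sum.inl D.zeroIdx) := by
  simp [starComponent]

lemma zeroIdx_mem_component (b : Closure F) : D.zeroIdx ∈ D.component b :=
  D.mem_component.mpr (SimpleGraph.Reachable.refl _)

/-- The factors `ψ_i` and the factors `ψ_j^*` in the connected component of `x - α` have the same
product, because each root of `f(x) - f(α)` is a root of exactly one `ψ_i` and one `ψ_j^*`, which
are then adjacent. -/
lemma map_prod_component (hf' : derivative f ≠ 0) {b : Closure F}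
    (hbf : aeval b f = aeval (alphaBar F) f) (hb : Transcendental F b) :
    (∏ i ∈ D.component b, D.ψ i).map (algebraMap (RatFunc F) (Closure F)) =
      (∏ j ∈ D.starComponent b, D.ψ j).map (evalHom hb : RatFunc F →+* Closure F) := by
  have hs : (subAlpha f).map (evalHom hb : RatFunc F →+* Closure F) =
      (subAlpha f).map (algebraMap (RatFunc F) (Closure F)) := by
    rw [map_evalHom_subAlpha, map_subAlpha, hbf]
  have hd₁ := Polynomial.map_dvd (algebraMap (RatFunc F) (Closure F))
    (D.prod_dvd (D.component b))
  have hd₂ := Polynomial.map_dvd (evalHom hb : RatFunc F →+* Closure F)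
    (D.prod_dvd (D.starComponent b))
  rw [hs] at hd₂
  refine eq_of_dvd_separable (separable_map_subAlpha hf') ((D.monic_prod _).map _)
    ((D.monic_prod _).map _) hd₁ hd₂ fun γ => ⟨fun hγ => ?_, fun hγ => ?_⟩
  · obtain ⟨j, hj⟩ := D.exists_root_index (evalHom hb : RatFunc F →+* Closure F) (γ := γ) (by
      rw [hs]
      exact eval_eq_zero_of_dvd_of_eval_eq_zero hd₁ hγ)
    rw [eval_prod_map_eq_zero_iff] at hγ ⊢
    obtain ⟨i, hi, hγ⟩ := hγ
    exact ⟨j, D.mem_starComponent.mpr ((D.adj_of_common_root hb hγ hj).symm.reachable.trans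
      (D.mem_component.mp hi)), hj⟩
  · obtain ⟨i, hi⟩ := D.exists_root_index (algebraMap (RatFunc F) (Closure F))
      (eval_eq_zero_of_dvd_of_eval_eq_zero hd₂ hγ)
    rw [eval_prod_map_eq_zero_iff] at hγ ⊢
    obtain ⟨j, hj, hγ⟩ := hγ
    exact ⟨i, D.mem_component.mpr ((D.adj_of_common_root hb hi hγ).reachable.trans
      (D.mem_starComponent.mp hj)), hi⟩

/-- The factors connected to `x - α` form a polynomial `h(x) - h(α)`. -/
lemma exists_subAlpha_eq_component (hf : f.Monic) (hf' : derivative f ≠ 0) {b : Closure F}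
    (hbf : aeval b f = aeval (alphaBar F) f) (hb : Transcendental F b) :
    ∃ h : F[X], IsNormal h ∧ subAlpha h = ∏ i ∈ D.component b, D.ψ i := by
  have hn := natDegree_pos_of_derivative_ne_zero hf'
  have hd := D.prod_dvd (D.component b)
  obtain ⟨P', -, -, hP'⟩ := exists_lift_of_dvd_subAlpha hf hn (D.monic_prod _) hd
  refine exists_subAlpha_eq hf hf' (D.monic_prod _) hd ?_ fun γ hγ hγt k => ?_
  · rw [eval_prod]
    refine Finset.prod_eq_zero (D.zeroIdx_mem_component b) ?_
    rw [ψ_zeroIdx, eval_sub, eval_X, eval_C, sub_self]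
  · rw [← eval_map_algebraMap, eval_prod_map_eq_zero_iff] at hγ
    obtain ⟨i, hi, hγ⟩ := hγ
    have hcoeff := congrArg (fun p => p.coeff k) (D.map_prod_component hf' hbf hb)
    simp only [← hP', coeff_map] at hcoeff ⊢
    rw [← atAlpha_eq, ← aeval_alphaBar] at hcoeff ⊢
    rw [evalHom_atAlpha]
    exact D.aeval_eq_of_reachable hb hcoeff.symm (D.mem_component.mp hi).symm γ hγ

/-- If `x - α` were a component of its own, it would be equal to some `ψ_j^* = x - ℓ(β)`, hence
`β ∈ F(α)`, contrary to `deg ψ_ν ≥ 2`. -/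
lemma two_le_natDegree_component (hf : f.Monic) (hf' : derivative f ≠ 0) {ν : Fin D.r}
    (hν : D.s ≤ (ν : ℕ)) {b : Closure F} (hbν : aeval b (D.ψ ν) = 0)
    (hbf : aeval b f = aeval (alphaBar F) f) (hb : Transcendental F b) :
    2 ≤ (∏ i ∈ D.component b, D.ψ i).natDegree := by
  by_contra! hlt
  have hn := natDegree_pos_of_derivative_ne_zero hf'
  have hroot : ((∏ j ∈ D.starComponent b, D.ψ j).map
      (evalHom hb : RatFunc F →+* Closure F)).eval (alphaBar F) = 0 := by
    rw [← D.map_prod_component hf' hbf hb, eval_prod_map_eq_zero_iff]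
    exact ⟨_, D.zeroIdx_mem_component b, by simp [ψ_zeroIdx, alphaBar]⟩
  rw [eval_prod_map_eq_zero_iff] at hroot
  obtain ⟨j, hj, hroot⟩ := hroot
  have hdeg := congrArg natDegree (D.map_prod_component hf' hbf hb)
  rw [natDegree_map, natDegree_map] at hdeg
  have hjs : (j : ℕ) < D.s := by
    by_contra! hjs
    have := natDegree_le_of_dvd (Finset.dvd_prod_of_mem D.ψ hj) (D.monic_prod _).ne_zero
    have := D.two_le_natDegree j hjs
    omega
  have hψ : D.ψ j = X - C (D.root ⟨j, hjs⟩) := D.ψ_linear ⟨j, hjs⟩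
  obtain ⟨l, hl, hlr, -⟩ := exists_linear hf hn (c := D.root ⟨j, hjs⟩)
    (eval_eq_zero_of_dvd_of_eval_eq_zero (D.ψ_dvd j) (by simp [hψ]))
  rw [hψ, Polynomial.map_sub, map_X, map_C, eval_sub, eval_X, eval_C, sub_eq_zero, ← hlr,
    RingHom.coe_coe, evalHom_atAlpha] at hroot
  -- Solving `ℓ(β) = α` for `β`.
  obtain ⟨a, ha, c, rfl⟩ := natDegree_eq_one.mp hl
  have hb' : b = algebraMap (RatFunc F) (Closure F)
      ((RatFunc.X - algebraMap F (RatFunc F) c) / algebraMap F (RatFunc F) a) := by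
    have ha' : algebraMap F (Closure F) a ≠ 0 := by simpa using ha
    rw [alphaBar] at hroot
    rw [map_div₀, map_sub, hroot, ← IsScalarTower.algebraMap_apply,
      ← IsScalarTower.algebraMap_apply]
    simp [ha']
  rw [hb', aeval_algebraMap_apply, map_eq_zero, coe_aeval_eq_eval] at hbν
  have h1 : (D.ψ ν).natDegree = 1 := natDegree_eq_of_degree_eq_some
    (degree_eq_one_of_irreducible_of_root (D.irreducible ν) hbν)
  have := D.two_le_natDegree ν hν
  omega

/-- A pass of the loop over the nonlinear factors does not fail, it yields decompositions only, and
it yields each minimal decomposition `(g, h)` for which `ψ_ν` divides `h(x) - h(α)`. -/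
lemma pass_spec (hf : f.Monic) (hf' : derivative f ≠ 0) {ν : Fin D.r} (hν : D.s ≤ (ν : ℕ))
    {b : Closure F} (hbν : aeval b (D.ψ ν) = 0) :
    ∃ L, D.pass b = some L ∧ (∀ p ∈ L, IsDecomposition f p.1 p.2) ∧
      ∀ g h, IsMinimalDecomposition f g h → D.ψ ν ∣ subAlpha h → (g, h) ∈ L := by
  classical
  have hn := natDegree_pos_of_derivative_ne_zero hf'
  have hroot : ∀ {p : F[X]}, D.ψ ν ∣ subAlpha p → aeval b p = aeval (alphaBar F) p := by
    rintro p ⟨Q, hQ⟩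
    rw [← aeval_subAlpha_eq_zero_iff, hQ, map_mul, hbν, zero_mul]
  have hbf := hroot (D.ψ_dvd ν)
  have hb := transcendental_of_aeval_eq hn hbf
  obtain ⟨h, hh, hI⟩ := D.exists_subAlpha_eq_component hf hf' hbf hb
  have h2 : 2 ≤ h.natDegree := by
    rw [← natDegree_subAlpha, hI]
    exact D.two_le_natDegree_component hf hf' hν hbν hbf hb
  obtain ⟨g, hg⟩ := (subAlpha_dvd_iff hh (by omega) f).mp (hI ▸ D.prod_dvd _)
  -- Minimality: the component is contained in each block that contains `β`.
  have hmin : ∀ g' h', IsMinimalDecomposition f g' h' → D.ψ ν ∣ subAlpha h' → h = h' := by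
    intro g' h' hmd hνh
    have hpos : 0 < h'.natDegree := by have := hmd.1.2.1; omega
    refine hmd.2.2.eq_of_dvd hmd.2.1 hmd.1.2.1 hh h2 ?_
    have hdf : subAlpha h' ∣ subAlpha f := (subAlpha_dvd_iff hmd.2.1 hpos f).mpr ⟨g', hmd.1.2.2⟩
    rw [hI, ← D.prod_filter_dvd hf' (monic_subAlpha hmd.2.1.1 hpos) hdf]
    refine Finset.prod_dvd_prod_of_subset _ _ _ fun i hi => ?_
    refine Finset.mem_filter.mpr ⟨Finset.mem_univ i, ?_⟩
    obtain ⟨γ, hγ⟩ := D.exists_root i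
    refine dvd_of_common_root _ (D.irreducible i) hγ ?_
    rw [eval_map_algebraMap, aeval_subAlpha_eq_zero_iff]
    exact D.aeval_eq_of_reachable hb (d := atAlpha h') (by rw [evalHom_atAlpha, hroot hνh])
      (D.mem_component.mp hi).symm γ hγ
  by_cases huniv : D.component b = Finset.univ
  · refine ⟨[], by simp [pass, huniv], by simp, fun g' h' hmd hνh => ?_⟩
    have hlt := hmd.1.natDegree_lt
    rw [← hmin g' h' hmd hνh, ← natDegree_subAlpha h, hI, huniv, D.prod_eq,
      natDegree_subAlpha] at hlt
    exact absurd hlt (lt_irrefl _)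
  · have hlt : h.natDegree < f.natDegree := by
      obtain ⟨i, hi⟩ : ∃ i, i ∉ D.component b := by
        by_contra! hall
        exact huniv (Finset.eq_univ_of_forall hall)
      have hle := natDegree_le_of_dvd (D.prod_dvd (insert i (D.component b)))
        (monic_subAlpha hf hn).ne_zero
      rw [Finset.prod_insert hi, (D.monic i).natDegree_mul (D.monic_prod _), ← hI,
        natDegree_subAlpha, natDegree_subAlpha] at hle
      have := (D.irreducible i).natDegree_pos
      omega
    have hpass : D.pass b = some [(g, h)] := by
      rw [pass, if_pos huniv, D.fromIndices_eq_some hh (by omega) hI hg]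
      rfl
    refine ⟨_, hpass, ?_, fun g' h' hmd hνh => ?_⟩
    · simpa using isDecomposition_of_comp hg h2 hlt
    · obtain rfl := hmin g' h' hmd hνh
      rw [comp_left_injective (by omega) (hmd.1.2.2.symm.trans hg)]
      simp

end Factorization

/-! ### The blocks found by `Atkinson` -/

lemma atkinson_of_isPrimitive {Z : Type*} [Fintype Z] {G : Subgroup (Equiv.Perm Z)}
    (h : IsPrimitive G) (a : Z) : atkinson G a = [Finset.univ] :=
  if_pos h

lemma mem_atkinson_of_not_isPrimitive {Z : Type*} [Fintype Z] {G : Subgroup (Equiv.Perm Z)}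
    (h : ¬ IsPrimitive G) {a : Z} {Λ : Finset Z} :
    Λ ∈ atkinson G a ↔ IsMinimalBlock G (Λ : Set Z) ∧ a ∈ Λ := by
  simp [atkinson, h]

lemma isBlock_of_mem_atkinson {Z : Type*} [Fintype Z] [Nontrivial Z]
    {G : Subgroup (Equiv.Perm Z)} {a : Z} {Λ : Finset Z} (h : Λ ∈ atkinson G a) :
    MulAction.IsBlock G (Λ : Set Z) ∧ a ∈ Λ ∧ 2 ≤ Λ.card := by
  by_cases hprim : IsPrimitive G
  · rw [atkinson_of_isPrimitive hprim, List.mem_singleton] at h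
    subst h
    exact ⟨by rw [Finset.coe_univ]; exact MulAction.IsBlock.univ, Finset.mem_univ a,
      Fintype.one_lt_card⟩
  · rw [mem_atkinson_of_not_isPrimitive hprim] at h
    refine ⟨h.1.1, h.2, ?_⟩
    have hns : ¬ (Λ : Set Z).Subsingleton := fun hs => h.1.2.1 (Or.inl hs)
    rw [Set.not_subsingleton_iff, ← Set.one_lt_ncard_iff_nontrivial,
      Set.ncard_coe_finset] at hns
    exact hns

namespace Factorization

variable {F : Type*} [Field F] {f : F[X]} (D : Factorization f)

open scoped Pointwise

/-! ### The group of linear polynomials `ℓ` with `f ∘ ℓ = f` -/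

lemma mem_Bα {c : RatFunc F} : c ∈ D.Bα ↔ ∃ i, D.root i = c := by
  simp [Bα]

lemma mem_Bα_iff {c : RatFunc F} : c ∈ D.Bα ↔ (subAlpha f).eval c = 0 := by
  rw [mem_Bα]
  constructor
  · rintro ⟨i, rfl⟩
    refine eval_eq_zero_of_dvd_of_eval_eq_zero (D.ψ_dvd (Fin.castLE D.s_le_r i)) ?_
    simp [D.ψ_linear]
  · intro hc
    obtain ⟨i, hi⟩ := D.exists_root_index (RingHom.id _) (γ := c) (by rwa [Polynomial.map_id])
    rw [Polynomial.map_id] at hi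
    have his : (i : ℕ) < D.s := by
      by_contra! his
      have h1 : (D.ψ i).natDegree = 1 := natDegree_eq_of_degree_eq_some
        (degree_eq_one_of_irreducible_of_root (D.irreducible i) hi)
      have := D.two_le_natDegree i his
      omega
    refine ⟨⟨i, his⟩, ?_⟩
    have hψ : D.ψ i = X - C (D.root ⟨i, his⟩) := D.ψ_linear ⟨i, his⟩
    rw [hψ, eval_sub, eval_X, eval_C, sub_eq_zero] at hi
    exact hi.symm

lemma root_mem_Bα (i : Fin D.s) : D.root i ∈ D.Bα :=
  D.mem_Bα.mpr ⟨i, rfl⟩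

lemma card_Bα_le : Fintype.card D.Bα ≤ D.s := by
  classical
  rw [Fintype.card_coe, Bα]
  exact Finset.card_image_le.trans (Finset.card_fin _).le

lemma root_injective (hf' : derivative f ≠ 0) : Function.Injective D.root := fun i j hij => by
  have := D.eq_of_common_root hf' (RingHom.id _) (γ := D.root i) (i := Fin.castLE D.s_le_r i)
    (j := Fin.castLE D.s_le_r j) (by simp [D.ψ_linear]) (by simp [D.ψ_linear, hij])
  exact Fin.castLE_injective _ this

lemma eval₂_mem_Bα {l : F[X]} (hl : f.comp l = f) {c : RatFunc F} (hc : c ∈ D.Bα) :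
    l.eval₂ RatFunc.C c ∈ D.Bα := by
  rw [mem_Bα_iff, eval_subAlpha] at hc ⊢
  rwa [← eval₂_comp, hl]

lemma prod_X_sub_C_dvd (Λ : Finset D.Bα) : ∏ γ ∈ Λ, (X - C (γ : RatFunc F)) ∣ subAlpha f :=
  Finset.prod_dvd_of_coprime
    (fun _ _ _ _ h => pairwise_coprime_X_sub_C Subtype.val_injective h)
    (fun γ _ => dvd_iff_isRoot.mpr (D.mem_Bα_iff.mp γ.2))

lemma exists_linear_of_mem (hf : f.Monic) (hn : 0 < f.natDegree) (γ : D.Bα) :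
    ∃ l : F[X], l.natDegree = 1 ∧ atAlpha l = γ ∧ f.comp l = f :=
  exists_linear hf hn (D.mem_Bα_iff.mp γ.2)

/-- The permutations of `B_α` of the form `γ ↦ ℓ(γ)`, where `f ∘ ℓ = f`. -/
noncomputable def symGroup (hf : f.Monic) (hn : 0 < f.natDegree) :
    Subgroup (Equiv.Perm D.Bα) where
  carrier := {σ | ∃ l : F[X], f.comp l = f ∧
    ∀ γ : D.Bα, ((σ γ : D.Bα) : RatFunc F) = l.eval₂ RatFunc.C (γ : RatFunc F)}
  one_mem' := ⟨X, comp_X, fun γ => by simp⟩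
  mul_mem' := by
    rintro σ τ ⟨l, hl, hσ⟩ ⟨m, hm, hτ⟩
    refine ⟨l.comp m, by rw [← comp_assoc, hl, hm], fun γ => ?_⟩
    rw [Equiv.Perm.mul_apply, hσ, hτ, eval₂_comp]
  inv_mem' := by
    rintro σ ⟨l, hl, hσ⟩
    -- The inverse of `ℓ` is the polynomial `m` with `m(α) = σ⁻¹(α)`.
    obtain ⟨m, -, hmα, hm⟩ := D.exists_linear_of_mem hf hn (σ⁻¹ D.α)
    have hlm : l.comp m = X := by
      apply atAlpha_injective
      rw [atAlpha_comp, hmα, ← hσ, ← Equiv.Perm.mul_apply, mul_inv_cancel, Equiv.Perm.one_apply]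
      simp [α, atAlpha]
    refine ⟨m, hm, fun γ => ?_⟩
    have : σ⁻¹ γ = ⟨m.eval₂ RatFunc.C γ, D.eval₂_mem_Bα hm γ.2⟩ := by
      rw [Equiv.Perm.inv_eq_iff_eq]
      apply Subtype.ext
      rw [hσ, ← eval₂_comp, hlm, eval₂_X]
    rw [this]

lemma mem_symGroup {hf : f.Monic} {hn : 0 < f.natDegree} {σ : Equiv.Perm D.Bα} :
    σ ∈ D.symGroup hf hn ↔ ∃ l : F[X], f.comp l = f ∧
      ∀ γ : D.Bα, ((σ γ : D.Bα) : RatFunc F) = l.eval₂ RatFunc.C (γ : RatFunc F) :=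
  Iff.rfl

lemma exists_perm (hf : f.Monic) (hn : 0 < f.natDegree) {l : F[X]} (hl : f.comp l = f) :
    ∃ σ : D.symGroup hf hn, ∀ γ : D.Bα,
      ((σ • γ : D.Bα) : RatFunc F) = l.eval₂ RatFunc.C (γ : RatFunc F) := by
  have hinj : Function.Injective fun γ : D.Bα =>
      (⟨l.eval₂ RatFunc.C γ, D.eval₂_mem_Bα hl γ.2⟩ : D.Bα) := fun γ δ h =>
    Subtype.ext (eval₂_injective (natDegree_eq_one_of_comp_eq hn hl) (congrArg Subtype.val h))
  exact ⟨⟨Equiv.ofBijective _ (Finite.injective_iff_bijective.mp hinj), l, hl, fun γ => rfl⟩,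
    fun γ => rfl⟩

lemma exists_smul_α_eq (hf : f.Monic) (hn : 0 < f.natDegree) (γ : D.Bα) :
    ∃ σ : D.symGroup hf hn, σ • D.α = γ := by
  obtain ⟨l, -, hlγ, hl⟩ := D.exists_linear_of_mem hf hn γ
  obtain ⟨σ, hσ⟩ := D.exists_perm hf hn hl
  exact ⟨σ, Subtype.ext ((hσ _).trans hlγ)⟩

/-! ### Blocks of `B_α` -/

/-- If `Λ` is a block containing `α`, then `∏_{γ ∈ Λ} (x - γ) = h(x) - h(α)`. The substitution of
`δ ∈ Λ` for `α` only permutes the factors: it replaces `γ = ℓ(α)` by `ℓ(δ)`, and the permutation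
given by `ℓ` maps `α ∈ Λ` to `γ ∈ Λ`, so it preserves `Λ`. -/
lemma exists_subAlpha_eq_block (hf : f.Monic) (hf' : derivative f ≠ 0) (hn : 0 < f.natDegree)
    {Λ : Finset D.Bα} (hΛ : MulAction.IsBlock (D.symGroup hf hn) (Λ : Set D.Bα)) (hα : D.α ∈ Λ) :
    ∃ h : F[X], IsNormal h ∧ subAlpha h = ∏ γ ∈ Λ, (X - C (γ : RatFunc F)) := by
  classical
  refine exists_subAlpha_eq hf hf' (monic_prod_of_monic _ _ fun γ _ => monic_X_sub_C _)
    (D.prod_X_sub_C_dvd Λ) ?_ fun γ hγ hγt k => ?_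
  · rw [eval_prod]
    exact Finset.prod_eq_zero hα (by simp [α])
  · obtain ⟨δ, hδ, hγδ⟩ : ∃ δ ∈ Λ, γ = algebraMap (RatFunc F) (Closure F) δ := by
      rw [map_prod, Finset.prod_eq_zero_iff] at hγ
      obtain ⟨δ, hδ, h⟩ := hγ
      exact ⟨δ, hδ, by simpa [sub_eq_zero] using h⟩
    have hmaps : Λ.image (fun ε : D.Bα => evalHom hγt (ε : RatFunc F)) =
        Λ.image (fun ε : D.Bα => algebraMap (RatFunc F) (Closure F) (ε : RatFunc F)) := by
      refine Finset.eq_of_subset_of_card_le (fun x hx => ?_) ?_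
      · obtain ⟨ε, hε, rfl⟩ := Finset.mem_image.mp hx
        obtain ⟨l, -, hlε, hl⟩ := D.exists_linear_of_mem hf hn ε
        obtain ⟨σ, hσ⟩ := D.exists_perm hf hn hl
        have hσα : σ • D.α = ε := Subtype.ext ((hσ _).trans hlε)
        have hσΛ : σ • (Λ : Set D.Bα) = Λ :=
          MulAction.isBlock_iff_smul_eq_of_nonempty.mp hΛ
            ⟨ε, ⟨D.α, hα, hσα⟩, hε⟩
        have hmem : σ • δ ∈ (Λ : Set D.Bα) := by
          rw [← hσΛ]
          exact Set.smul_mem_smul_set hδ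
        refine Finset.mem_image.mpr ⟨σ • δ, hmem, ?_⟩
        rw [hσ, ← hlε, evalHom_atAlpha, hγδ, aeval_algebraMap_apply, aeval_def,
          RatFunc.algebraMap_eq_C]
      · exact ((Finset.card_image_of_injective Λ
          ((algebraMap (RatFunc F) (Closure F)).injective.comp Subtype.val_injective)).trans
          (Finset.card_image_of_injective Λ
          ((evalHom hγt : RatFunc F →+* Closure F).injective.comp
            Subtype.val_injective)).symm).le
    have hprod : (∏ ε ∈ Λ, (X - C (ε : RatFunc F))).map (evalHom hγt : RatFunc F →+* Closure F) =
        (∏ ε ∈ Λ, (X - C (ε : RatFunc F))).map (algebraMap (RatFunc F) (Closure F)) := by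
      have h₁ := Finset.prod_image (f := fun x : Closure F => X - C x) (s := Λ)
        (((evalHom hγt : RatFunc F →+* Closure F).injective.comp
          Subtype.val_injective).injOn)
      have h₂ := Finset.prod_image (f := fun x : Closure F => X - C x) (s := Λ)
        (((algebraMap (RatFunc F) (Closure F)).injective.comp Subtype.val_injective).injOn)
      simp only [Polynomial.map_prod, Polynomial.map_sub, map_X, map_C]
      exact h₁.symm.trans ((congrArg (fun s => ∏ x ∈ s, (X - C x)) hmaps).trans h₂)
    have := congrArg (fun p => p.coeff k) hprod
    simpa only [coeff_map, RingHom.coe_coe] using this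

lemma natDegree_eq_card {Λ : Finset D.Bα} {h : F[X]}
    (hh : subAlpha h = ∏ γ ∈ Λ, (X - C (γ : RatFunc F))) : h.natDegree = Λ.card := by
  rw [← natDegree_subAlpha, hh, natDegree_prod_of_monic _ _ fun γ _ => monic_X_sub_C _]
  simp

lemma fromBlock_eq_some {Λ : Finset D.Bα} {g h : F[X]} (hh : IsNormal h) (h0 : 0 < h.natDegree)
    (hΛ : subAlpha h = ∏ γ ∈ Λ, (X - C (γ : RatFunc F))) (hg : f = g.comp h) :
    D.fromBlock Λ = some (g, h) := by
  have hc : ∏ γ ∈ Λ, (-(γ : RatFunc F)) = -atAlpha h := by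
    have := congrArg (eval 0) hΛ
    rw [eval_subAlpha, eval_prod, eval₂_at_zero, coeff_zero_eq_eval_zero, hh.2, map_zero,
      zero_sub] at this
    rw [this]
    simp
  have hmap : h.map RatFunc.C =
      (∏ γ ∈ Λ, (X - C (γ : RatFunc F))) - C (∏ γ ∈ Λ, (-(γ : RatFunc F))) := by
    rw [← hΛ, hc, subAlpha, C_neg]
    ring
  have e₁ : (compute fun h : F[X] => h.map RatFunc.C =
      (∏ γ ∈ Λ, (X - C (γ : RatFunc F))) - C (∏ γ ∈ Λ, (-(γ : RatFunc F)))) = some h :=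
    compute_eq_some hmap fun p hp => map_injective _ RatFunc.C_injective (hp.trans hmap.symm)
  have e₂ : (compute fun g : F[X] => f = g.comp h) = some g :=
    compute_eq_some hg fun p hp => comp_left_injective h0 (hp.symm.trans hg)
  simp only [fromBlock, e₁, e₂, Option.bind_eq_bind, Option.bind_some]
  rfl

/-- A block `Λ` containing `α`, with more than one and fewer than `n` points, yields a
decomposition. -/
lemma fromBlock_spec (hf : f.Monic) (hf' : derivative f ≠ 0) (hn : 0 < f.natDegree)
    {Λ : Finset D.Bα} (hΛ : MulAction.IsBlock (D.symGroup hf hn) (Λ : Set D.Bα)) (hα : D.α ∈ Λ)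
    (h2 : 2 ≤ Λ.card) (hlt : Λ.card < f.natDegree) :
    ∃ g h, D.fromBlock Λ = some (g, h) ∧ IsDecomposition f g h := by
  obtain ⟨h, hh, hprod⟩ := D.exists_subAlpha_eq_block hf hf' hn hΛ hα
  rw [← D.natDegree_eq_card hprod] at h2 hlt
  have hd : subAlpha h ∣ subAlpha f := hprod ▸ D.prod_X_sub_C_dvd Λ
  obtain ⟨g, hg⟩ := (subAlpha_dvd_iff hh (by omega) f).mp hd
  exact ⟨g, h, D.fromBlock_eq_some hh (by omega) hprod hg, isDecomposition_of_comp hg h2 hlt⟩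

open Classical in
/-- The set `{γ ∈ B_α : h(γ) = h(α)}`. -/
noncomputable def fiber (h : F[X]) : Finset D.Bα :=
  Finset.univ.filter fun γ => h.eval₂ RatFunc.C (γ : RatFunc F) = atAlpha h

lemma mem_fiber {h : F[X]} {γ : D.Bα} :
    γ ∈ D.fiber h ↔ h.eval₂ RatFunc.C (γ : RatFunc F) = atAlpha h := by
  simp [fiber]

lemma α_mem_fiber (h : F[X]) : D.α ∈ D.fiber h :=
  D.mem_fiber.mpr rfl

/-- If `ℓ` maps one point of the fibre of `h` into the fibre, then `h ∘ ℓ = h`, so `ℓ` maps the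
fibre into itself. -/
lemma isBlock_fiber (hf : f.Monic) (hn : 0 < f.natDegree) (h : F[X]) :
    MulAction.IsBlock (D.symGroup hf hn) (D.fiber h : Set D.Bα) := by
  rw [MulAction.isBlock_iff_smul_eq_of_nonempty]
  rintro σ ⟨x, ⟨y, hy, hxy⟩, hx⟩
  obtain ⟨l, hl, hσ⟩ := σ.2
  have hσ' : ∀ γ : D.Bα, ((σ • γ : D.Bα) : RatFunc F) = l.eval₂ RatFunc.C (γ : RatFunc F) := hσ
  obtain ⟨m, hm1, hmy, hm⟩ := D.exists_linear_of_mem hf hn y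
  have hhl : h.comp l = h := by
    apply comp_left_injective (h := m) (by omega)
    apply atAlpha_injective
    rw [atAlpha_comp, atAlpha_comp, hmy, eval₂_comp, ← hσ', D.mem_fiber.mp hy]
    exact D.mem_fiber.mp (show σ • y ∈ D.fiber h from (show σ • y = x from hxy) ▸ hx)
  refine Set.eq_of_subset_of_ncard_le ?_ ?_ (Set.toFinite _)
  · rintro _ ⟨z, hz, rfl⟩
    refine D.mem_fiber.mpr ?_
    change h.eval₂ RatFunc.C ((σ • z : D.Bα) : RatFunc F) = _
    rw [hσ', ← eval₂_comp, hhl]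
    exact D.mem_fiber.mp hz
  · exact (Set.ncard_image_of_injective _ (MulAction.injective σ)).ge

/-- If all irreducible factors of `h(x) - h(α)` are linear, its roots form the fibre of `h`. -/
lemma subAlpha_eq_prod_fiber (hf' : derivative f ≠ 0) {h : F[X]} (hh : IsNormal h)
    (h0 : 0 < h.natDegree) (hd : subAlpha h ∣ subAlpha f)
    (hlin : ∀ i, D.ψ i ∣ subAlpha h → (i : ℕ) < D.s) :
    subAlpha h = ∏ γ ∈ D.fiber h, (X - C (γ : RatFunc F)) := by
  apply map_injective _ (algebraMap (RatFunc F) (Closure F)).injective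
  refine eq_of_dvd_separable (separable_map_subAlpha hf') ((monic_subAlpha hh.1 h0).map _)
    ((monic_prod_of_monic _ _ fun γ _ => monic_X_sub_C _).map _) (Polynomial.map_dvd _ hd)
    (Polynomial.map_dvd _ (D.prod_X_sub_C_dvd _)) fun γ => ?_
  constructor
  · intro hγ
    obtain ⟨i, hi⟩ := D.exists_root_index (algebraMap (RatFunc F) (Closure F))
      (eval_eq_zero_of_dvd_of_eval_eq_zero (Polynomial.map_dvd _ hd) hγ)
    have his := hlin i (dvd_of_common_root _ (D.irreducible i) hi hγ)
    have hψ : D.ψ i = X - C (D.root ⟨i, his⟩) := D.ψ_linear ⟨i, his⟩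
    rw [hψ, Polynomial.map_sub, map_X, map_C, eval_sub, eval_X, eval_C, sub_eq_zero] at hi
    rw [Polynomial.map_prod, eval_prod]
    refine Finset.prod_eq_zero (i := ⟨D.root ⟨i, his⟩, D.root_mem_Bα _⟩) (D.mem_fiber.mpr ?_)
      (by simp [hi])
    rw [hi, eval_map_apply, map_eq_zero, eval_subAlpha, sub_eq_zero] at hγ
    exact hγ
  · rw [Polynomial.map_prod, eval_prod, Finset.prod_eq_zero_iff]
    rintro ⟨δ, hδ, hγ⟩
    rw [Polynomial.map_sub, map_X, map_C, eval_sub, eval_X, eval_C, sub_eq_zero] at hγ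
    rw [hγ, eval_map_apply, eval_subAlpha, D.mem_fiber.mp hδ, sub_self, map_zero]

/-- Each nontrivial block contained in the fibre of an indecomposable `h` is the whole fibre. -/
lemma eq_fiber_of_isBlock (hf : f.Monic) (hf' : derivative f ≠ 0) (hn : 0 < f.natDegree) {h : F[X]}
    (hh : IsNormal h) (h2 : 2 ≤ h.natDegree) (hind : IsIndecomposable h)
    (hprod : subAlpha h = ∏ γ ∈ D.fiber h, (X - C (γ : RatFunc F))) {B : Set D.Bα}
    (hB : MulAction.IsBlock (D.symGroup hf hn) B) (hBsub : B ⊆ D.fiber h)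
    (hBs : ¬ B.Subsingleton) : B = D.fiber h := by
  classical
  obtain ⟨y, hy⟩ := (Set.not_subsingleton_iff.mp hBs).nonempty
  -- A translate of the block contains `α`.
  obtain ⟨σ, hσ⟩ : ∃ σ : D.symGroup hf hn, σ • y = D.α := by
    obtain ⟨τ, hτ⟩ := D.exists_smul_α_eq hf hn y
    exact ⟨τ⁻¹, by rw [← hτ, inv_smul_smul]⟩
  have hσfiber : σ • (D.fiber h : Set D.Bα) = D.fiber h :=
    MulAction.isBlock_iff_smul_eq_of_nonempty.mp (D.isBlock_fiber hf hn h)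
      ⟨D.α, ⟨y, hBsub hy, hσ⟩, D.α_mem_fiber h⟩
  have hσsub : σ • B ⊆ D.fiber h := by
    rw [← hσfiber]
    exact Set.smul_set_mono hBsub
  set Λ : Finset D.Bα := (σ • B).toFinset with hΛ
  have hΛB : (Λ : Set D.Bα) = σ • B := Set.coe_toFinset _
  have hαΛ : D.α ∈ Λ := by
    rw [← Finset.mem_coe, hΛB]
    exact ⟨y, hy, hσ⟩
  have hcard : Λ.card = B.ncard := by
    rw [← Set.ncard_coe_finset, hΛB]
    exact Set.ncard_image_of_injective _ (MulAction.injective σ)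
  obtain ⟨p, hp, hpΛ⟩ := D.exists_subAlpha_eq_block hf hf' hn
    (by rw [hΛB]; exact hB.translate σ) hαΛ
  have hp2 : 2 ≤ p.natDegree := by
    rw [D.natDegree_eq_card hpΛ, hcard]
    exact Set.one_lt_ncard_iff_nontrivial.mpr (Set.not_subsingleton_iff.mp hBs)
  have hpd : subAlpha p ∣ subAlpha h := by
    rw [hprod, hpΛ]
    refine Finset.prod_dvd_prod_of_subset _ _ _ ?_
    rw [← Finset.coe_subset, hΛB]
    exact hσsub
  have hph := hind.eq_of_dvd hh h2 hp hp2 hpd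
  refine Set.eq_of_subset_of_ncard_le hBsub ?_ (Set.toFinite _)
  rw [Set.ncard_coe_finset, ← D.natDegree_eq_card hprod, ← hph, D.natDegree_eq_card hpΛ, hcard]

/-- The fibre of an indecomposable `h` is in the list of blocks. -/
lemma fiber_mem_atkinson (hf : f.Monic) (hf' : derivative f ≠ 0) (hn : 0 < f.natDegree) {h : F[X]}
    (hh : IsNormal h) (h2 : 2 ≤ h.natDegree) (hind : IsIndecomposable h)
    (hprod : subAlpha h = ∏ γ ∈ D.fiber h, (X - C (γ : RatFunc F))) :
    D.fiber h ∈ atkinson (D.symGroup hf hn) D.α := by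
  have hns : ¬ (D.fiber h : Set D.Bα).Subsingleton := by
    rw [Set.not_subsingleton_iff, ← Set.one_lt_ncard_iff_nontrivial, Set.ncard_coe_finset,
      ← D.natDegree_eq_card hprod]
    omega
  have key := fun {B} => D.eq_fiber_of_isBlock hf hf' hn hh h2 hind hprod (B := B)
  by_cases hprim : IsPrimitive (D.symGroup hf hn)
  · rcases hprim _ (D.isBlock_fiber hf hn h) with hs | hu
    · exact absurd hs hns
    · rw [atkinson_of_isPrimitive hprim, List.mem_singleton, ← Finset.coe_eq_univ, hu]
  · rw [mem_atkinson_of_not_isPrimitive hprim]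
    refine ⟨⟨D.isBlock_fiber hf hn h, ?_, fun B hBsub hB => ?_⟩,
      D.α_mem_fiber h⟩
    · rintro (hs | hu)
      · exact hns hs
      · refine hprim fun B hB => ?_
        by_cases hBs : B.Subsingleton
        · exact Or.inl hBs
        · exact Or.inr ((key hB (hu ▸ Set.subset_univ B) hBs).trans hu)
    · by_cases hBs : B.Subsingleton
      · exact Or.inl (Or.inl hBs)
      · exact Or.inr (key hB hBsub hBs)

end Factorization

/-! ### Running the algorithm -/

lemma exists_mapM_eq_some {A B : Type*} {φ : A → Option B} (l : List A)
    (h : ∀ x ∈ l, ∃ y, φ x = some y) :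
    ∃ L, l.mapM φ = some L ∧ ∀ y, y ∈ L ↔ ∃ x ∈ l, φ x = some y := by
  induction l with
  | nil => exact ⟨[], by simp⟩
  | cons x l ih =>
    obtain ⟨y, hy⟩ := h x List.mem_cons_self
    obtain ⟨L, hL, hmem⟩ := ih fun z hz => h z (List.mem_cons_of_mem x hz)
    refine ⟨y :: L, by simp [hy, hL], fun z => ?_⟩
    rw [List.mem_cons, hmem]
    simp [hy, eq_comm]

namespace Factorization

variable {F : Type*} [Field F] {f : F[X]} (D : Factorization f)

lemma exists_linearMaps_eq_some (hf : f.Monic) (hn : 0 < f.natDegree) :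
    ∃ H, D.linearMaps = some H ∧ ∀ l, l ∈ H ↔ f.comp l = f := by
  have key : ∀ i : Fin D.s, ∃ l : F[X], f.comp l = f ∧ atAlpha l = D.root i ∧
      (compute fun l : F[X] => l.natDegree = 1 ∧ atAlpha l = D.root i) = some l := by
    intro i
    obtain ⟨l, hl1, hlr, hl⟩ := D.exists_linear_of_mem hf hn ⟨_, D.root_mem_Bα i⟩
    exact ⟨l, hl, hlr, compute_eq_some ⟨hl1, hlr⟩ fun p hp =>
      atAlpha_injective (hp.2.trans hlr.symm)⟩
  obtain ⟨H, hH, hmem⟩ := exists_mapM_eq_some (List.finRange D.s) fun i _ =>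
    let ⟨l, _, _, hl⟩ := key i
    ⟨l, hl⟩
  refine ⟨H, hH, fun l => ?_⟩
  rw [hmem]
  constructor
  · rintro ⟨i, -, hi⟩
    obtain ⟨m, hm, -, hm'⟩ := key i
    rw [hi, Option.some_inj] at hm'
    rwa [hm']
  · intro hl
    have hX : l.eval₂ RatFunc.C RatFunc.X ∈ D.Bα := D.eval₂_mem_Bα hl D.α.2
    obtain ⟨i, hi⟩ := D.mem_Bα.mp hX
    obtain ⟨m, -, hm, hm'⟩ := key i
    refine ⟨i, List.mem_finRange i, hm'.trans ?_⟩
    rw [atAlpha_injective (hm.trans hi)]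

lemma permGroup_eq_some (hf : f.Monic) (hn : 0 < f.natDegree) {H : List F[X]}
    (hH : ∀ l, l ∈ H ↔ f.comp l = f) : D.permGroup H = some (D.symGroup hf hn) := by
  refine compute_eq_some ⟨fun l hl => ?_, fun σ ⟨l, hl, hσ⟩ => ⟨l, (hH l).mpr hl, hσ⟩⟩
    fun G hG => ?_
  · obtain ⟨σ, hσ⟩ := D.exists_perm hf hn ((hH l).mp hl)
    exact ⟨σ, σ.2, hσ⟩
  · ext σ
    rw [mem_symGroup]
    constructor
    · intro h
      obtain ⟨l, hl, hσ⟩ := hG.2 σ h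
      exact ⟨l, (hH l).mp hl, hσ⟩
    · rintro ⟨l, hl, hσ⟩
      obtain ⟨τ, hτ, hτl⟩ := hG.1 l ((hH l).mpr hl)
      have : σ = τ := Equiv.ext fun γ => Subtype.ext ((hσ γ).trans (hτl γ).symm)
      rwa [this]

/-- The part of the algorithm for `s > 1` does not fail, it yields decompositions only, and it
yields each minimal decomposition `(g, h)` for which `h(x) - h(α)` has only linear factors. -/
lemma linearPart_spec (hf : f.Monic) (hf' : derivative f ≠ 0) :
    ∃ L, D.linearPart = some L ∧ (∀ p ∈ L, IsDecomposition f p.1 p.2) ∧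
      ∀ g h, IsMinimalDecomposition f g h → (∀ i, D.ψ i ∣ subAlpha h → (i : ℕ) < D.s) →
        (g, h) ∈ L := by
  have hn := natDegree_pos_of_derivative_ne_zero hf'
  have hprod : ∀ g h, IsMinimalDecomposition f g h →
      (∀ i, D.ψ i ∣ subAlpha h → (i : ℕ) < D.s) →
      subAlpha h = ∏ γ ∈ D.fiber h, (X - C (γ : RatFunc F)) := by
    intro g h hmd hlin
    have h0 : 0 < h.natDegree := by have := hmd.1.2.1; omega
    exact D.subAlpha_eq_prod_fiber hf' hmd.2.1 h0
      ((subAlpha_dvd_iff hmd.2.1 h0 f).mpr ⟨g, hmd.1.2.2⟩) hlin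
  by_cases hs : 1 < D.s
  · obtain ⟨H, hH, hmem⟩ := D.exists_linearMaps_eq_some hf hn
    have hG := D.permGroup_eq_some hf hn hmem
    have : Nontrivial D.Bα := by
      refine ⟨⟨_, D.root_mem_Bα ⟨0, D.s_pos⟩⟩, ⟨_, D.root_mem_Bα ⟨1, hs⟩⟩, fun h => ?_⟩
      have := D.root_injective hf' (congrArg Subtype.val h)
      simp at this
    have hblock : ∀ Λ ∈ (atkinson (D.symGroup hf hn) D.α).filter
        (fun Λ => decide (Λ.card < f.natDegree)),
        ∃ p : F[X] × F[X], D.fromBlock Λ = some p ∧ IsDecomposition f p.1 p.2 := by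
      intro Λ hΛ
      rw [List.mem_filter, decide_eq_true_eq] at hΛ
      obtain ⟨hB, hα, h2⟩ := isBlock_of_mem_atkinson hΛ.1
      obtain ⟨g, h, hgh, hd⟩ := D.fromBlock_spec hf hf' hn hB hα h2 hΛ.2
      exact ⟨(g, h), hgh, hd⟩
    obtain ⟨L, hL, hLmem⟩ := exists_mapM_eq_some _ fun Λ hΛ =>
      (hblock Λ hΛ).imp fun p hp => hp.1
    refine ⟨L, by simp [linearPart, hs, hH, hG, hL], fun p hp => ?_, fun g h hmd hlin => ?_⟩
    · obtain ⟨Λ, hΛ, hp⟩ := (hLmem p).mp hp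
      obtain ⟨q, hq, hqd⟩ := hblock Λ hΛ
      rw [hp, Option.some_inj] at hq
      rwa [hq]
    · have hpr := hprod g h hmd hlin
      rw [hLmem]
      refine ⟨D.fiber h, ?_, D.fromBlock_eq_some hmd.2.1 (by have := hmd.1.2.1; omega) hpr
        hmd.1.2.2⟩
      rw [List.mem_filter, decide_eq_true_eq, ← D.natDegree_eq_card hpr]
      exact ⟨D.fiber_mem_atkinson hf hf' hn hmd.2.1 hmd.1.2.1 hmd.2.2 hpr, hmd.1.natDegree_lt⟩
  · refine ⟨[], by simp [linearPart, hs], by simp, fun g h hmd hlin => ?_⟩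
    have h2 := hmd.1.2.1
    rw [D.natDegree_eq_card (hprod g h hmd hlin)] at h2
    have := (D.fiber h).card_le_univ
    have := D.card_Bα_le
    omega

end Factorization

/-! ### Existence of the factorization -/

section Existence

variable {F : Type*} [Field F]

open UniqueFactorizationMonoid in
lemma nonempty_factorization {f : F[X]} (hf : f.Monic) (hn : 0 < f.natDegree) :
    Nonempty (Factorization f) := by
  classical
  have hm := monic_subAlpha hf hn
  set M := normalizedFactors (subAlpha f) with hM
  have hirr : ∀ p ∈ M, Irreducible p := fun p hp => irreducible_of_normalized_factor p hp
  have hmon : ∀ p ∈ M, p.Monic := fun p hp => by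
    rw [← normalize_normalized_factor p hp]
    exact monic_normalize (hirr p hp).ne_zero
  have hprod : M.prod = subAlpha f := by
    rw [hM, prod_normalizedFactors_eq hm.ne_zero, hm.normalize_eq_self]
  have hX : X - C RatFunc.X ∈ M := by
    rw [hM, mem_normalizedFactors_iff' hm.ne_zero]
    exact ⟨irreducible_X_sub_C _, (monic_X_sub_C _).normalize_eq_self,
      dvd_iff_isRoot.mpr (eval_X_subAlpha f)⟩
  obtain ⟨M', hM'⟩ := Multiset.exists_cons_of_mem hX
  -- The linear factors, with `x - α` in front, and the other factors.
  set l₁ : List (RatFunc F)[X] :=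
    (X - C RatFunc.X) :: (M'.filter fun p => p.natDegree = 1).toList with hl₁
  set l₂ : List (RatFunc F)[X] := (M'.filter fun p => ¬ p.natDegree = 1).toList with hl₂
  have hl : ((l₁ ++ l₂ : List _) : Multiset (RatFunc F)[X]) = M := by
    rw [← Multiset.coe_add, hl₁, hl₂, ← Multiset.cons_coe, Multiset.coe_toList,
      Multiset.coe_toList, Multiset.cons_add, Multiset.filter_add_not, hM']
  have hmem : ∀ p, p ∈ l₁ ++ l₂ → p ∈ M := fun p hp => by
    rw [← hl]
    exact hp
  have hdeg₁ : ∀ p ∈ l₁, p.natDegree = 1 := by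
    intro p hp
    rw [hl₁, List.mem_cons, Multiset.mem_toList, Multiset.mem_filter] at hp
    rcases hp with rfl | hp
    · exact natDegree_X_sub_C _
    · exact hp.2
  have hdeg₂ : ∀ p ∈ l₂, 2 ≤ p.natDegree := by
    intro p hp
    have hpos := (hirr p (hmem p (List.mem_append_right _ hp))).natDegree_pos
    rw [hl₂, Multiset.mem_toList, Multiset.mem_filter] at hp
    have := hp.2
    omega
  refine ⟨{
    r := (l₁ ++ l₂).length
    s := l₁.length
    s_pos := by simp [hl₁]
    s_le_r := by simp
    root := fun i => -(l₁.get i).coeff 0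
    ψ := (l₁ ++ l₂).get
    root_zero := by simp [hl₁]
    ψ_linear := fun i => ?_
    two_le_natDegree := fun i hi => ?_
    monic := fun i => hmon _ (hmem _ (List.get_mem _ i))
    irreducible := fun i => hirr _ (hmem _ (List.get_mem _ i))
    prod_eq := ?_ }⟩
  · have e : (l₁ ++ l₂).get (Fin.castLE (by simp) i) = l₁.get i := by
      simp [List.getElem_append_left]
    have hi := List.get_mem l₁ i
    rw [e, C_neg, sub_neg_eq_add]
    exact (hmon _ (hmem _ (List.mem_append_left _ hi))).eq_X_add_C (hdeg₁ _ hi)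
  · have e : (l₁ ++ l₂).get i ∈ l₂ := by
      rw [List.get_eq_getElem, List.getElem_append_right hi]
      exact List.getElem_mem _
    exact hdeg₂ _ e
  · rw [← hprod, ← hl, Multiset.prod_coe]
    simp

lemma nonempty_choices {f : F[X]} (hf : f.Monic) (hn : 0 < f.natDegree) :
    Nonempty (Choices f) := by
  obtain ⟨D⟩ := nonempty_factorization hf hn
  choose β hβ using D.exists_root
  exact ⟨{ D with
    β := fun ν _ => β ν
    β_root := fun ν _ => by rw [← eval_map_algebraMap]; exact hβ ν }⟩

end Existence

end MinDec

theorem mainTheorem2 {F : Type*} [Field F] (f : Polynomial F) (hf : f.Monic)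
    (hf' : Polynomial.derivative f ≠ 0) :
    Nonempty (MinDec.Choices f) ∧
    ∀ D : MinDec.Choices f, ∃ L : List (Polynomial F × Polynomial F),
      MinDec.minDec f D = some L ∧
      (∀ g h : Polynomial F, (g, h) ∈ L → MinDec.IsDecomposition f g h) ∧
      (∀ g h : Polynomial F, MinDec.IsMinimalDecomposition f g h → (g, h) ∈ L) ∧
      (MinDec.IsIndecomposable f → L = []) := by
  refine ⟨MinDec.nonempty_choices hf (MinDec.natDegree_pos_of_derivative_ne_zero hf'),
    fun D => ?_⟩
  obtain ⟨L₁, hL₁, hdec₁, hmin₁⟩ := D.toFactorization.linearPart_spec hf hf'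
  have hpass : ∀ ν : Fin D.r, ∃ L,
      (if hν : D.s ≤ (ν : ℕ) then D.pass (D.β ν hν) else return []) = some L ∧
      (∀ p ∈ L, MinDec.IsDecomposition f p.1 p.2) ∧
      (D.s ≤ (ν : ℕ) → ∀ g h, MinDec.IsMinimalDecomposition f g h →
        D.ψ ν ∣ MinDec.subAlpha h → (g, h) ∈ L) := by
    intro ν
    by_cases hν : D.s ≤ (ν : ℕ)
    · obtain ⟨L, hL, hdec, hmin⟩ :=
        D.toFactorization.pass_spec hf hf' hν (D.β_root ν hν)
      exact ⟨L, by rw [dif_pos hν, hL], hdec, fun _ => hmin⟩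
    · exact ⟨[], by rw [dif_neg hν]; rfl, by simp, fun h => absurd h hν⟩
  obtain ⟨L₂, hL₂, hmem₂⟩ := MinDec.exists_mapM_eq_some (List.finRange D.r) fun ν _ =>
    (hpass ν).imp fun L hL => hL.1
  have hdec : ∀ g h : Polynomial F, (g, h) ∈ L₁ ++ L₂.flatten →
      MinDec.IsDecomposition f g h := by
    intro g h hgh
    rcases List.mem_append.mp hgh with hgh | hgh
    · exact hdec₁ _ hgh
    · obtain ⟨L, hL, hgh⟩ := List.mem_flatten.mp hgh
      obtain ⟨ν, -, hν⟩ := (hmem₂ L).mp hL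
      obtain ⟨L', hL', hdec', -⟩ := hpass ν
      rw [hν, Option.some_inj] at hL'
      subst hL'
      exact hdec' _ hgh
  refine ⟨L₁ ++ L₂.flatten, ?_, hdec, fun g h hmd => ?_, fun hind => ?_⟩
  · rw [MinDec.minDec, hL₁]
    simp only [Option.bind_eq_bind, Option.bind_some]
    rw [hL₂]
    rfl
  · by_cases hlin : ∀ i, D.ψ i ∣ MinDec.subAlpha h → (i : ℕ) < D.s
    · exact List.mem_append_left _ (hmin₁ g h hmd hlin)
    · push Not at hlin
      obtain ⟨ν, hνh, hν⟩ := hlin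
      obtain ⟨L, hL, -, hmin⟩ := hpass ν
      exact List.mem_append_right _ (List.mem_flatten.mpr
        ⟨L, (hmem₂ L).mpr ⟨ν, List.mem_finRange ν, hL⟩, hmin hν g h hmd hνh⟩)
  · exact List.eq_nil_iff_forall_not_mem.mpr fun p hp => hind ⟨p.1, p.2, hdec _ _ hp⟩
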